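/- Let $G$ be a finite group. A $G$-Tambara functor $R$ assigns to every finite $G$-set $X$ a commutative ring $R(X)$, with restrictions (ring homomorphisms), transfers (additive maps) and norms (multiplicative maps) along all maps of finite $G$-sets, each functorial, such that disjoint unions are sent to products, transfers and norms satisfy base change along pullback squares, and norms distribute over transfers along exponential diagrams. A Tambara ideal $I$ of $R$ is a family of ideals $I(G/H)\subseteq R(G/H)$, for $H\le G$, closed under restrictions, transfers, norms and conjugations. The product $I\cdot J$ is the smallest Tambara ideal containing $I(G/H)\cdot J(G/H)$ for all $H\le G$. A Tambara ideal $\mathfrak p$ is prime if $\mathfrak p\neq R$ and $I\cdot J\subseteq\mathfrak p$ implies $I\subseteq\mathfrak p$ or $J\subseteq\mathfrak p$. The Nakaoka spectrum $\mathrm{Spec}(R)$ is the set of prime Tambara ideals of $R$, with the topology generated by the closed subsets $V(I)=\{\mathfrak p : I\subseteq\mathfrak p\}$, for $I$ a Tambara ideal. The group $G$ acts on $R(G/e)$ by restriction along right multiplications on $G/e$; $R$ is clarified if there is no nonzero idempotent $d\in R(G/e)$ with $d\cdot gd=0$ for some $g\in G$. The same notions apply to every subgroup $H$ of $G$ in place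 of $G$. Theorem. Let $R$ be a $G$-Tambara functor such that the ring $R(G/e)$ is Noetherian. Then there is a family $(R_H)_{H\le G}$, indexed by all subgroups $H$ of $G$, in which each $R_H$ is a clarified $H$-Tambara functor (possibly zero), and a homeomorphism $$\mathrm{Spec}(R)\;\cong\;\coprod_{H\le G}\mathrm{Spec}(R_H).$$ -/

import Mathlib

universe u v

section GSets

variable {G : Type u} [Group G]

/-- The commutative square of `G`-sets with top `u : E → X`, left `v : E → B`, right `f : X → Y`
and bottom `q : B → Y` is a pullback square. -/
structure IsPullbackSquare {E X B Y : Type u} [MulAction G E] [MulAction G X] [MulAction G B]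
    [MulAction G Y] (u : E →[G] X) (v : E →[G] B) (f : X →[G] Y) (q : B →[G] Y) : Prop where
  comm : ∀ t, f (u t) = q (v t)
  existsUnique : ∀ x b, f x = q b → ∃! t, u t = x ∧ v t = b

/-- The diagram `X ←p- A ←e- E -f'→ B -q→ Y`, together with `f : X → Y`, is an exponential diagram:
`B` is the dependent product of `p : A → X` along `f` (a point of `B` over `y` is a section of `p`
over the fibre of `f` at `y`), `E` is the pullback `X ×_Y B`, and `e : E → A` is the evaluation. -/
structure IsExponentialDiagram {X Y A B E : Type u} [MulAction G X] [MulAction G Y] [MulAction G A]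
    [MulAction G B] [MulAction G E] (p : A →[G] X) (f : X →[G] Y) (e : E →[G] A) (f' : E →[G] B)
    (q : B →[G] Y) : Prop where
  isPullback : IsPullbackSquare (p.comp e) f' f q
  existsUnique : ∀ (y : Y) (s : {x : X // f x = y} → A), (∀ x, p (s x) = x) →
    ∃! b : B, q b = y ∧
      ∀ (t : E) (x : {x : X // f x = y}), f' t = b → p (e t) = x → e t = s x

end GSets

/-- A `G`-Tambara functor, for a finite group `G`, given by its values on all finite `G`-sets:
commutative rings `obj X` with restrictions, transfers and norms along all maps of `G`-sets, which
turn disjoint unions into products, satisfy base change along pullback squares, and satisfy the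
distributive law for exponential diagrams. -/
structure TambaraFunctor (G : Type u) [Group G] where
  obj (X : Type u) [MulAction G X] [Finite X] : Type v
  [commRing (X : Type u) [MulAction G X] [Finite X] : CommRing (obj X)]
  /-- restriction -/
  res {X Y : Type u} [MulAction G X] [Finite X] [MulAction G Y] [Finite Y] (f : X →[G] Y) :
    obj Y →+* obj X
  /-- transfer -/
  tr {X Y : Type u} [MulAction G X] [Finite X] [MulAction G Y] [Finite Y] (f : X →[G] Y) :
    obj X →+ obj Y
  /-- norm -/
  nm {X Y : Type u} [MulAction G X] [Finite X] [MulAction G Y] [Finite Y] (f : X →[G] Y) :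
    obj X →* obj Y
  res_id (X : Type u) [MulAction G X] [Finite X] (a : obj X) : res (MulActionHom.id G) a = a
  tr_id (X : Type u) [MulAction G X] [Finite X] (a : obj X) : tr (MulActionHom.id G) a = a
  nm_id (X : Type u) [MulAction G X] [Finite X] (a : obj X) : nm (MulActionHom.id G) a = a
  res_comp {X Y Z : Type u} [MulAction G X] [Finite X] [MulAction G Y] [Finite Y] [MulAction G Z]
    [Finite Z] (g : Y →[G] Z) (f : X →[G] Y) (a : obj Z) : res (g.comp f) a = res f (res g a)
  tr_comp {X Y Z : Type u} [MulAction G X] [Finite X] [MulAction G Y] [Finite Y] [MulAction G Z]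
    [Finite Z] (g : Y →[G] Z) (f : X →[G] Y) (a : obj X) : tr (g.comp f) a = tr g (tr f a)
  nm_comp {X Y Z : Type u} [MulAction G X] [Finite X] [MulAction G Y] [Finite Y] [MulAction G Z]
    [Finite Z] (g : Y →[G] Z) (f : X →[G] Y) (a : obj X) : nm (g.comp f) a = nm g (nm f a)
  /-- The value at the empty `G`-set is the zero ring. -/
  subsingleton_of_isEmpty (X : Type u) [MulAction G X] [Finite X] [IsEmpty X] :
    Subsingleton (obj X)
  /-- If `Z` is the disjoint union of `X` and `Y` via `i` and `j`, then
  `obj Z → obj X × obj Y` is bijective. -/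
  bijective_of_sum {X Y Z : Type u} [MulAction G X] [Finite X] [MulAction G Y] [Finite Y]
    [MulAction G Z] [Finite Z] (i : X →[G] Z) (j : Y →[G] Z)
    (h : Function.Bijective (Sum.elim i j : X ⊕ Y → Z)) :
    Function.Bijective (fun a : obj Z => (res i a, res j a))
  /-- Base change for transfers. -/
  res_tr {E X B Y : Type u} [MulAction G E] [Finite E] [MulAction G X] [Finite X] [MulAction G B]
    [Finite B] [MulAction G Y] [Finite Y] {u : E →[G] X} {v : E →[G] B} {f : X →[G] Y}
    {q : B →[G] Y} (h : IsPullbackSquare u v f q) (a : obj X) : res q (tr f a) = tr v (res u a)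
  /-- Base change for norms. -/
  res_nm {E X B Y : Type u} [MulAction G E] [Finite E] [MulAction G X] [Finite X] [MulAction G B]
    [Finite B] [MulAction G Y] [Finite Y] {u : E →[G] X} {v : E →[G] B} {f : X →[G] Y}
    {q : B →[G] Y} (h : IsPullbackSquare u v f q) (a : obj X) : res q (nm f a) = nm v (res u a)
  /-- Distributivity of norms over transfers. -/
  nm_tr {X Y A B E : Type u} [MulAction G X] [Finite X] [MulAction G Y] [Finite Y] [MulAction G A]
    [Finite A] [MulAction G B] [Finite B] [MulAction G E] [Finite E] {p : A →[G] X} {f : X →[G] Y}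
    {e : E →[G] A} {f' : E →[G] B} {q : B →[G] Y} (h : IsExponentialDiagram p f e f' q)
    (a : obj A) : nm f (tr p a) = tr q (nm f' (res e a))

namespace TambaraFunctor

variable {G : Type u} [Group G]

attribute [instance] TambaraFunctor.commRing

/-- Right multiplication by `g` on the `G`-set `G/e`. -/
def rightMul (g : G) : (G ⧸ (⊥ : Subgroup G)) →[G] (G ⧸ (⊥ : Subgroup G)) where
  toFun x := x * (g : G ⧸ (⊥ : Subgroup G))
  map_smul' a x := by
    induction x using QuotientGroup.induction_on with
    | H b => exact congrArg (QuotientGroup.mk (s := (⊥ : Subgroup G))) (mul_assoc a b g)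

variable [Finite G] (R : TambaraFunctor.{u, v} G)

/-- The ring `R(G/H)`. -/
abbrev level (H : Subgroup G) : Type v := R.obj (G ⧸ H)

/-- The action of `g : G` on the ring `R(G/e)`: restriction along right multiplication by `g`. -/
def conj (g : G) : R.level ⊥ →+* R.level ⊥ := R.res (rightMul g)

/-- `R` is clarified if `R(G/e)` has no nonzero idempotent `d` with `d * g d = 0` for some `g`. -/
def IsClarified : Prop :=
  ¬ ∃ d : R.level ⊥, d ≠ 0 ∧ IsIdempotentElem d ∧ ∃ g : G, d * R.conj g d = 0

/-- A Tambara ideal of `R`: ideals of the rings `R(G/H)` which are closed under transfers, norms and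
restrictions along all maps `G/K → G/H` of `G`-sets. Each such map is a conjugation isomorphism
followed by a projection `G/K' → G/H` with `K' ≤ H`, so this comprises transfers, norms and
restrictions along inclusions of subgroups, and conjugations. -/
@[ext]
structure TambaraIdeal where
  carrier : ∀ H : Subgroup G, Ideal (R.level H)
  tr_mem : ∀ {K H : Subgroup G} (f : (G ⧸ K) →[G] (G ⧸ H)) {a : R.level K},
    a ∈ carrier K → R.tr f a ∈ carrier H
  nm_mem : ∀ {K H : Subgroup G} (f : (G ⧸ K) →[G] (G ⧸ H)) {a : R.level K},
    a ∈ carrier K → R.nm f a ∈ carrier H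
  res_mem : ∀ {K H : Subgroup G} (f : (G ⧸ K) →[G] (G ⧸ H)) {a : R.level H},
    a ∈ carrier H → R.res f a ∈ carrier K

namespace TambaraIdeal

variable {R}

/-- Levelwise inclusion of Tambara ideals. -/
instance : PartialOrder R.TambaraIdeal :=
  PartialOrder.lift TambaraIdeal.carrier (fun _ _ h => TambaraIdeal.ext h)

/-- The unit ideal. -/
instance : Top R.TambaraIdeal where
  top :=
    { carrier := fun _ => ⊤
      tr_mem := fun _ _ _ => Submodule.mem_top
      nm_mem := fun _ _ _ => Submodule.mem_top
      res_mem := fun _ _ _ => Submodule.mem_top }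

/-- The levelwise intersection of a set of Tambara ideals. -/
instance : InfSet R.TambaraIdeal where
  sInf S :=
    { carrier := fun H => ⨅ I ∈ S, I.carrier H
      tr_mem := fun f _ ha => by
        simp only [Submodule.mem_iInf] at ha ⊢
        exact fun I hI => I.tr_mem f (ha I hI)
      nm_mem := fun f _ ha => by
        simp only [Submodule.mem_iInf] at ha ⊢
        exact fun I hI => I.nm_mem f (ha I hI)
      res_mem := fun f _ ha => by
        simp only [Submodule.mem_iInf] at ha ⊢
        exact fun I hI => I.res_mem f (ha I hI) }

/-- The product of `I` and `J`: the smallest Tambara ideal that contains all products `a * b` with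
`a` in `I(G/H)` and `b` in `J(G/H)`. -/
instance : Mul R.TambaraIdeal where
  mul I J := sInf {L | ∀ (H : Subgroup G), ∀ a ∈ I.carrier H, ∀ b ∈ J.carrier H,
    a * b ∈ L.carrier H}

/-- A Tambara ideal is prime if it is proper and contains `I` or `J` whenever it contains `I * J`. -/
structure IsPrime (P : R.TambaraIdeal) : Prop where
  ne_top : P ≠ ⊤
  le_or_le : ∀ I J : R.TambaraIdeal, I * J ≤ P → I ≤ P ∨ J ≤ P

end TambaraIdeal

/-- The set of prime Tambara ideals of `R`. -/
structure NakaokaSpectrum where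
  ideal : R.TambaraIdeal
  isPrime : ideal.IsPrime

namespace NakaokaSpectrum

variable {R}

/-- The set `V(I)` of prime Tambara ideals that contain `I`. -/
def V (I : R.TambaraIdeal) : Set R.NakaokaSpectrum := {P | I ≤ P.ideal}

/-- The topology generated by the sets `V(I)` as closed sets. -/
instance : TopologicalSpace R.NakaokaSpectrum :=
  TopologicalSpace.generateFrom {U | ∃ I : R.TambaraIdeal, U = (V I)ᶜ}

end NakaokaSpectrum

end TambaraFunctor

/-!
Let `T` be a finite `G`-set and `d` a complete system of orthogonal idempotents of `R(G/e)`, indexed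
equivariantly by `T`. The element of `R(G/e × T)` whose value at `(x, t)` is `d t` transfers to `1`
over `G/e`. Its norm along `G/e × T → T` is an idempotent `τ` of `R(T)` with value `d t` at `t`, and
by distributivity `τ` transfers to `1` over the point. Being a norm from a free `G`-set, `τ` is
determined by its values, so its pullbacks along two disjoint maps are orthogonal and it absorbs
its own norms. Hence an orbit `t : G/H → T` cuts out of the restriction of `R` to `H` a direct
factor, the pullback of `τ` being its unit, and the ideals of `R` decompose along these factors,
compatibly with products. This splits the spectrum over the orbits of `T`.

Now apply this to the primitive idempotents of `R(G/e)`. Mapping each orbit of them onto the orbit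
`G/H` of its stabilizer and summing over the fibres indexes the system by the disjoint union of all
`G/H`. An idempotent of the `H`-th factor dominates a primitive idempotent fixed by `H`, so it is
not orthogonal to any of its conjugates: the factor is clarified.
-/

namespace GSet

section Hom

variable {G : Type*} [Group G] {H : Subgroup G} {X Y Z : Type*} [MulAction G X] [MulAction G Y]
  [MulAction G Z]

theorem hom_ext_of_apply_eq [MulAction.IsPretransitive G X] {f f' : X →[G] Y} (x : X)
    (h : f x = f' x) : f = f' := by
  ext x'
  obtain ⟨g, rfl⟩ := MulAction.exists_smul_eq G x x'
  rw [map_smul, map_smul, h]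

theorem surjective_of_isPretransitive [MulAction.IsPretransitive G Y] [Nonempty X] (f : X →[G] Y) :
    Function.Surjective f := by
  intro y
  obtain ⟨x⟩ := ‹Nonempty X›
  obtain ⟨g, rfl⟩ := MulAction.exists_smul_eq G (f x) y
  exact ⟨g • x, map_smul f g x⟩

/-- The map `G/H → X` that sends the base point to a point fixed by `H`. -/
def orbitMap (x : X) (hx : H ≤ MulAction.stabilizer G x) : (G ⧸ H) →[G] X where
  toFun y := MulAction.ofQuotientStabilizer G x (Subgroup.quotientMapOfLE hx y)
  map_smul' g y := by
    induction y using QuotientGroup.induction_on with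
    | H k => exact mul_smul g k x

theorem orbitMap_injective (x : X) :
    Function.Injective (orbitMap x (le_refl (MulAction.stabilizer G x))) := by
  intro a b
  induction a using QuotientGroup.induction_on
  induction b using QuotientGroup.induction_on
  exact fun h => MulAction.injective_ofQuotientStabilizer G x h

theorem mk_smul_one (g : G) : g • ((1 : G) : G ⧸ H) = g := congrArg QuotientGroup.mk (mul_one g)

theorem le_stabilizer_apply_one (f : (G ⧸ H) →[G] X) :
    H ≤ MulAction.stabilizer G (f ((1 : G) : G ⧸ H)) := fun h hh => by
  have : h • ((1 : G) : G ⧸ H) = (1 : G) := by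
    rw [mk_smul_one]
    exact QuotientGroup.eq.2 (by simpa using hh)
  rw [MulAction.mem_stabilizer_iff, ← map_smul, this]

theorem exists_comp_eq_of_range_subset (f : X →[G] Z) (i : Y →[G] Z) (hi : Function.Injective i)
    (h : Set.range f ⊆ Set.range i) : ∃ k : X →[G] Y, i.comp k = f := by
  choose k hk using fun x => h ⟨x, rfl⟩
  exact ⟨⟨k, fun g x => hi (by rw [hk, map_smul, id, map_smul, hk])⟩, MulActionHom.ext hk⟩

theorem exists_comp_eq_of_isPretransitive [MulAction.IsPretransitive G X] (f : X →[G] Z)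
    (i : Y →[G] Z) (hi : Function.Injective i) {x : X} {y : Y} (h : i y = f x) :
    ∃ k : X →[G] Y, i.comp k = f := by
  refine exists_comp_eq_of_range_subset f i hi ?_
  rintro _ ⟨x', rfl⟩
  obtain ⟨g, rfl⟩ := MulAction.exists_smul_eq G x x'
  exact ⟨g • y, by rw [map_smul, map_smul, h]⟩

/-- The complement of the range of a map of `G`-sets. -/
def rangeCompl (f : X →[G] Y) : SubMulAction G Y where
  carrier := (Set.range f)ᶜ
  smul_mem' g y hy := by
    rintro ⟨x, hx⟩
    exact hy ⟨g⁻¹ • x, by rw [map_smul, hx, inv_smul_smul]⟩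

theorem bijective_sumElim_rangeCompl {f : X →[G] Y} (hf : Function.Injective f) :
    Function.Bijective (Sum.elim f (rangeCompl f).subtype) := by
  refine ⟨hf.sumElim Subtype.val_injective fun x y h => y.2 ⟨x, h⟩, fun y => ?_⟩
  by_cases hy : y ∈ Set.range f
  · obtain ⟨x, rfl⟩ := hy
    exact ⟨Sum.inl x, rfl⟩
  · exact ⟨Sum.inr ⟨y, hy⟩, rfl⟩

variable (G) in
/-- The free orbit `G/e`. -/
abbrev FreeOrbit : Type _ := G ⧸ (⊥ : Subgroup G)

instance : IsCancelSMul G (FreeOrbit G) where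
  right_cancel' a b x h := by
    induction x using QuotientGroup.induction_on with
    | H k =>
      have h : (a * k)⁻¹ * (b * k) ∈ (⊥ : Subgroup G) := QuotientGroup.eq.1 h
      exact mul_right_cancel (inv_mul_eq_one.1 (Subgroup.mem_bot.1 h))

instance [IsCancelSMul G X] : IsCancelSMul G (X × Y) where
  right_cancel' a b x h := IsCancelSMul.right_cancel a b x.1 (congrArg Prod.fst h)

theorem injective_of_isCancelSMul [MulAction.IsPretransitive G X] [IsCancelSMul G Y]
    (f : X →[G] Y) : Function.Injective f := by
  intro x x' h
  obtain ⟨g, rfl⟩ := MulAction.exists_smul_eq G x x'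
  rw [map_smul] at h
  rw [IsCancelSMul.eq_one_of_smul h.symm, one_smul]

/-- The map `G/e → X` that sends the base point to `x`. -/
def pt (x : X) : FreeOrbit G →[G] X := orbitMap x bot_le

@[simp]
theorem pt_mk (x : X) (g : G) : pt x (g : FreeOrbit G) = g • x := rfl

theorem pt_one (x : X) : pt x ((1 : G) : FreeOrbit G) = x := one_smul G x

theorem eq_pt (f : FreeOrbit G →[G] X) : f = pt (f ((1 : G) : FreeOrbit G)) :=
  hom_ext_of_apply_eq ((1 : G) : FreeOrbit G) (pt_one _).symm

theorem comp_pt (f : X →[G] Y) (x : X) : f.comp (pt x) = pt (f x) := by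
  rw [eq_pt (f.comp (pt x)), MulActionHom.comp_apply, pt_one]

theorem rightMul_mk (g k : G) :
    TambaraFunctor.rightMul g (k : FreeOrbit G) = (k * g : G) := rfl

theorem pt_smul (g : G) (x : X) : pt (g • x) = (pt x).comp (TambaraFunctor.rightMul g) := by
  rw [eq_pt ((pt x).comp _), MulActionHom.comp_apply, rightMul_mk, one_mul, pt_mk]

end Hom

section Orbits

variable {G : Type u} [Group G] {X : Type u} [MulAction G X] [Finite X]

theorem exists_orbit_decomposition (x : X) :
    ∃ (H : Subgroup G) (Y : Type u) (_ : MulAction G Y) (i : (G ⧸ H) →[G] X) (j : Y →[G] X),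
      Function.Bijective (Sum.elim i j) ∧ Nat.card Y < Nat.card X := by
  refine ⟨MulAction.stabilizer G x, rangeCompl (orbitMap x le_rfl), inferInstance,
    orbitMap x le_rfl, SubMulAction.subtype _, bijective_sumElim_rangeCompl (orbitMap_injective x),
    Finite.card_subtype_lt (x := x) fun h => h ⟨((1 : G) : G ⧸ _), one_smul G x⟩⟩

theorem orbit_induction {P : ∀ (X : Type u) [MulAction G X] [Finite X], Prop}
    (empty : ∀ (X : Type u) [MulAction G X] [Finite X] [IsEmpty X], P X)
    (sum : ∀ (X Y : Type u) [MulAction G X] [Finite X] [MulAction G Y] [Finite Y] (H : Subgroup G)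
      [Finite (G ⧸ H)] (i : (G ⧸ H) →[G] X) (j : Y →[G] X), Function.Bijective (Sum.elim i j) →
      P Y → P X)
    (X : Type u) [MulAction G X] [Finite X] : P X := by
  induction hn : Nat.card X using Nat.strong_induction_on generalizing X with
  | _ n ih =>
    rcases isEmpty_or_nonempty X with hX | ⟨⟨x⟩⟩
    · exact empty X
    · obtain ⟨H, Y, _, i, j, hij, hcard⟩ := exists_orbit_decomposition (G := G) x
      have : Finite (G ⧸ H) := Finite.of_injective i (hij.1.comp Sum.inl_injective)
      have : Finite Y := Finite.of_injective j (hij.1.comp Sum.inr_injective)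
      exact sum X Y H i j hij (ih _ (hn ▸ hcard) Y rfl)

end Orbits

section Squares

variable {G : Type u} [Group G] {X Y Z : Type u} [MulAction G X] [MulAction G Y] [MulAction G Z]

instance : MulAction G PEmpty.{u + 1} where
  smul _ x := x
  one_smul x := x.elim
  mul_smul _ _ x := x.elim

variable (G X) in
/-- The map from the empty `G`-set. -/
def fromEmpty : PEmpty.{u + 1} →[G] X := ⟨PEmpty.elim, fun _ x => x.elim⟩

theorem isPullbackSquare_fromEmpty (f : X →[G] Z) (q : Y →[G] Z) (h : ∀ x y, f x ≠ q y) :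
    IsPullbackSquare (fromEmpty G X) (fromEmpty G Y) f q :=
  ⟨fun t => t.elim, fun x y hxy => (h x y hxy).elim⟩

theorem isPullbackSquare_id_of_injective (f : X →[G] Y) (hf : Function.Injective f) :
    IsPullbackSquare (MulActionHom.id G) (MulActionHom.id G) f f :=
  ⟨fun _ => rfl, fun x _ h => ⟨x, ⟨rfl, hf h⟩, fun _ ht => ht.1⟩⟩

theorem isExponentialDiagram_fromEmpty_of_surjective (f : X →[G] Y) (hf : Function.Surjective f) :
    IsExponentialDiagram (fromEmpty G X) f (MulActionHom.id G) (MulActionHom.id G)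
      (fromEmpty G Y) := by
  refine ⟨⟨fun t => t.elim, fun _ b => b.elim⟩, fun y s _ => ?_⟩
  obtain ⟨x, hx⟩ := hf y
  exact (s ⟨x, hx⟩).elim

end Squares

end GSet

namespace TambaraFunctor

section Sums

variable {G : Type u} [Group G] (R : TambaraFunctor.{u, v} G) {X Y Z : Type u}
  [MulAction G X] [Finite X] [MulAction G Y] [Finite Y] [MulAction G Z] [Finite Z]

theorem res_tr_of_injective (f : X →[G] Y) (hf : Function.Injective f) (a : R.obj X) :
    R.res f (R.tr f a) = a := by
  rw [R.res_tr (GSet.isPullbackSquare_id_of_injective f hf), R.res_id, R.tr_id]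

theorem res_nm_of_injective (f : X →[G] Y) (hf : Function.Injective f) (a : R.obj X) :
    R.res f (R.nm f a) = a := by
  rw [R.res_nm (GSet.isPullbackSquare_id_of_injective f hf), R.res_id, R.nm_id]

instance [IsEmpty X] : Subsingleton (R.obj X) := R.subsingleton_of_isEmpty X

theorem res_tr_of_disjoint (f : X →[G] Z) (q : Y →[G] Z) (h : ∀ x y, f x ≠ q y) (a : R.obj X) :
    R.res q (R.tr f a) = 0 := by
  rw [R.res_tr (GSet.isPullbackSquare_fromEmpty f q h), Subsingleton.elim (R.res _ a) 0, map_zero]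

theorem res_nm_of_disjoint (f : X →[G] Z) (q : Y →[G] Z) (h : ∀ x y, f x ≠ q y) (a : R.obj X) :
    R.res q (R.nm f a) = 1 := by
  rw [R.res_nm (GSet.isPullbackSquare_fromEmpty f q h), Subsingleton.elim (R.res _ a) 1, map_one]

variable {i : X →[G] Z} {j : Y →[G] Z}

theorem ext_sum (h : Function.Bijective (Sum.elim i j)) {a b : R.obj Z}
    (hi : R.res i a = R.res i b) (hj : R.res j a = R.res j b) : a = b :=
  (R.bijective_of_sum i j h).1 (Prod.ext hi hj)

theorem tr_res_add_tr_res (h : Function.Bijective (Sum.elim i j)) (a : R.obj Z) :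
    R.tr i (R.res i a) + R.tr j (R.res j a) = a := by
  obtain ⟨hi, hj, hij⟩ := Sum.elim_injective.1 h.1
  refine R.ext_sum h ?_ ?_
  · rw [map_add, R.res_tr_of_injective i hi,
      R.res_tr_of_disjoint j i fun y x => (hij x y).symm, add_zero]
  · rw [map_add, R.res_tr_of_injective j hj, R.res_tr_of_disjoint i j hij, zero_add]

theorem nm_res_mul_nm_res (h : Function.Bijective (Sum.elim i j)) (a : R.obj Z) :
    R.nm i (R.res i a) * R.nm j (R.res j a) = a := by
  obtain ⟨hi, hj, hij⟩ := Sum.elim_injective.1 h.1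
  refine R.ext_sum h ?_ ?_
  · rw [map_mul, R.res_nm_of_injective i hi,
      R.res_nm_of_disjoint j i fun y x => (hij x y).symm, mul_one]
  · rw [map_mul, R.res_nm_of_injective j hj, R.res_nm_of_disjoint i j hij, one_mul]

variable {W : Type u} [MulAction G W] [Finite W]

theorem tr_eq_add (h : Function.Bijective (Sum.elim i j)) (f : Z →[G] W) (a : R.obj Z) :
    R.tr f a = R.tr (f.comp i) (R.res i a) + R.tr (f.comp j) (R.res j a) := by
  conv_lhs => rw [← R.tr_res_add_tr_res h a]
  rw [map_add, R.tr_comp, R.tr_comp]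

theorem nm_eq_mul (h : Function.Bijective (Sum.elim i j)) (f : Z →[G] W) (a : R.obj Z) :
    R.nm f a = R.nm (f.comp i) (R.res i a) * R.nm (f.comp j) (R.res j a) := by
  conv_lhs => rw [← R.nm_res_mul_nm_res h a]
  rw [map_mul, R.nm_comp, R.nm_comp]

theorem nm_zero_of_surjective (f : X →[G] Y) (hf : Function.Surjective f) : R.nm f 0 = 0 := by
  rw [← map_zero (R.tr (GSet.fromEmpty G X)),
    R.nm_tr (GSet.isExponentialDiagram_fromEmpty_of_surjective f hf),
    Subsingleton.elim (R.nm _ _) 0, map_zero]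

end Sums

end TambaraFunctor

namespace GSet

variable {G : Type u} [Group G] {X Y X' Y' : Type u} [MulAction G X] [MulAction G Y]
  [MulAction G X'] [MulAction G Y']

variable (G X Y) in
/-- The inclusion of the first summand. -/
def inl : X →[G] (X ⊕ Y) := ⟨Sum.inl, fun _ _ => rfl⟩

variable (G X Y) in
/-- The inclusion of the second summand. -/
def inr : Y →[G] (X ⊕ Y) := ⟨Sum.inr, fun _ _ => rfl⟩

/-- The disjoint union of two maps of `G`-sets. -/
def sumMap (f : X →[G] X') (f' : Y →[G] Y') : (X ⊕ Y) →[G] (X' ⊕ Y') where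
  toFun := Sum.map f f'
  map_smul' := by
    rintro g (x | y)
    · exact congrArg Sum.inl (map_smul f g x)
    · exact congrArg Sum.inr (map_smul f' g y)

variable (G X) in
/-- The fold map `X ⊔ X → X`. -/
def fold : (X ⊕ X) →[G] X := ⟨Sum.elim id id, by rintro g (x | x) <;> rfl⟩

variable (G X Y) in
theorem bijective_inl_inr : Function.Bijective (Sum.elim (inl G X Y) (inr G X Y)) := by
  have : Sum.elim (inl G X Y) (inr G X Y) = id := Sum.elim_inl_inr
  rw [this]
  exact Function.bijective_id

theorem isPullbackSquare_sumMap_inl (f : X →[G] X') (f' : Y →[G] Y') :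
    IsPullbackSquare (inl G X Y) f (sumMap f f') (inl G X' Y') := by
  refine ⟨fun _ => rfl, ?_⟩
  rintro (x | y) x' h
  · exact ⟨x, ⟨rfl, Sum.inl_injective h⟩, fun t ht => Sum.inl_injective ht.1⟩
  · exact (Sum.inr_ne_inl h).elim

theorem isPullbackSquare_sumMap_inr (f : X →[G] X') (f' : Y →[G] Y') :
    IsPullbackSquare (inr G X Y) f' (sumMap f f') (inr G X' Y') := by
  refine ⟨fun _ => rfl, ?_⟩
  rintro (x | y) y' h
  · exact (Sum.inl_ne_inr h).elim
  · exact ⟨y, ⟨rfl, Sum.inr_injective h⟩, fun t ht => Sum.inr_injective ht.1⟩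

theorem isPullbackSquare_sumMap_fold (f : X →[G] Y) :
    IsPullbackSquare (sumMap f f) (fold G X) (fold G Y) f := by
  refine ⟨by rintro (x | x) <;> rfl, ?_⟩
  rintro (y | y) x (rfl : y = f x)
  · refine ⟨Sum.inl x, ⟨rfl, rfl⟩, ?_⟩
    rintro (t | t) ⟨h, rfl⟩
    exacts [rfl, (Sum.inr_ne_inl h).elim]
  · refine ⟨Sum.inr x, ⟨rfl, rfl⟩, ?_⟩
    rintro (t | t) ⟨h, rfl⟩
    exacts [(Sum.inl_ne_inr h).elim, rfl]

-- A section of `f ⊔ id : X ⊔ Y → Y ⊔ Y` over the two points above `y` is a point of `f⁻¹(y)`.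
theorem isExponentialDiagram_fold (f : X →[G] Y) :
    IsExponentialDiagram (sumMap f (MulActionHom.id G)) (fold G Y) (sumMap (MulActionHom.id G) f)
      (fold G X) f := by
  have comp_eq : (sumMap f (MulActionHom.id G)).comp (sumMap (MulActionHom.id G) f) =
      sumMap f f := by
    ext (x | x) <;> rfl
  refine ⟨comp_eq ▸ isPullbackSquare_sumMap_fold f, fun y s hs => ?_⟩
  obtain ⟨x, hx, rfl⟩ : ∃ x, s ⟨Sum.inl y, rfl⟩ = Sum.inl x ∧ f x = y := by
    have h := hs ⟨Sum.inl y, rfl⟩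
    generalize s ⟨Sum.inl y, rfl⟩ = z at h ⊢
    rcases z with x | x
    exacts [⟨x, rfl, Sum.inl_injective h⟩, (Sum.inr_ne_inl h).elim]
  have hy : s ⟨Sum.inr (f x), rfl⟩ = Sum.inr (f x) := by
    have h := hs ⟨Sum.inr (f x), rfl⟩
    generalize s ⟨Sum.inr (f x), rfl⟩ = z at h ⊢
    rcases z with x' | x'
    exacts [(Sum.inl_ne_inr h).elim, congrArg Sum.inr (Sum.inr_injective h)]
  refine ⟨x, ⟨rfl, ?_⟩, fun x' ⟨hx', h⟩ => ?_⟩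
  · rintro (x' | x') ⟨y | y, rfl : y = f x⟩ (rfl : x' = x) h
    exacts [hx.symm, (Sum.inl_ne_inr h).elim, (Sum.inr_ne_inl h).elim, hy.symm]
  · exact Sum.inl_injective
      ((h (Sum.inl x') ⟨Sum.inl (f x), rfl⟩ rfl (congrArg Sum.inl hx')).trans hx)

end GSet

namespace TambaraFunctor

section Frobenius

variable {G : Type u} [Group G] (R : TambaraFunctor.{u, v} G) {X Y : Type u}
  [MulAction G X] [Finite X] [MulAction G Y] [Finite Y]

theorem nm_fold (a : R.obj (X ⊕ X)) :
    R.nm (GSet.fold G X) a = R.res (GSet.inl G X X) a * R.res (GSet.inr G X X) a := by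
  have fold_inl : (GSet.fold G X).comp (GSet.inl G X X) = MulActionHom.id G := rfl
  have fold_inr : (GSet.fold G X).comp (GSet.inr G X X) = MulActionHom.id G := rfl
  rw [R.nm_eq_mul (GSet.bijective_inl_inr G X X), fold_inl, fold_inr, R.nm_id, R.nm_id]

theorem tr_mul_res (f : X →[G] Y) (a : R.obj X) (b : R.obj Y) :
    R.tr f (a * R.res f b) = R.tr f a * b := by
  obtain ⟨c, hc⟩ := (R.bijective_of_sum _ _ (GSet.bijective_inl_inr G X Y)).2 (a, b)
  obtain ⟨rfl, rfl⟩ := Prod.mk.inj hc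
  have res_inl : R.res (GSet.inl G X X) (R.res (GSet.sumMap (MulActionHom.id G) f) c) =
      R.res (GSet.inl G X Y) c := (R.res_comp _ _ c).symm
  have res_inr : R.res (GSet.inr G X X) (R.res (GSet.sumMap (MulActionHom.id G) f) c) =
      R.res f (R.res (GSet.inr G X Y) c) := by
    rw [← R.res_comp, ← R.res_comp]
    rfl
  rw [← res_inl, ← res_inr, ← R.nm_fold, ← R.nm_tr (GSet.isExponentialDiagram_fold f), R.nm_fold,
    R.res_tr (GSet.isPullbackSquare_sumMap_inl f _),
    R.res_tr (GSet.isPullbackSquare_sumMap_inr f _), R.tr_id, res_inl]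

end Frobenius

end TambaraFunctor

namespace GSet

variable {G : Type u} [Group G] {X B Y : Type u} [MulAction G X] [MulAction G B] [MulAction G Y]

theorem exists_isPullbackSquare [Finite X] [Finite B] (f : X →[G] Y) (q : B →[G] Y) :
    ∃ (E : Type u) (_ : MulAction G E) (_ : Finite E) (u : E →[G] X) (v : E →[G] B),
      IsPullbackSquare u v f q := by
  let E : SubMulAction G (X × B) := ⟨{z | f z.1 = q z.2}, fun g z (hz : f z.1 = q z.2) =>
    show f (g • z.1) = q (g • z.2) by rw [map_smul, map_smul, hz]⟩
  exact ⟨E, inferInstance, inferInstance, (MulActionHom.fst G X B).comp E.subtype,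
    (MulActionHom.snd G X B).comp E.subtype, fun t => t.2,
    fun x b h => ⟨⟨(x, b), h⟩, ⟨rfl, rfl⟩, fun t ht => Subtype.ext (Prod.ext ht.1 ht.2)⟩⟩

theorem prod_fiber_eq_of_isPullbackSquare {E : Type u} [MulAction G E] [Fintype E] [Fintype X]
    [DecidableEq Y] [DecidableEq B] {u : E →[G] X} {v : E →[G] B} {f : X →[G] Y} {q : B →[G] Y}
    (h : IsPullbackSquare u v f q) {M : Type*} [CommMonoid M] (F : X → M) (b : B) :
    ∏ t with v t = b, F (u t) = ∏ x with f x = q b, F x := by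
  refine Finset.prod_bij (fun t _ => u t) (fun t ht => ?_) (fun t ht t' ht' htt' => ?_)
    (fun x hx => ?_) fun _ _ => rfl
  · rw [Finset.mem_filter_univ] at ht ⊢
    rw [h.comm, ht]
  · rw [Finset.mem_filter_univ] at ht ht'
    exact (h.existsUnique (u t') b (by rw [h.comm, ht'])).unique ⟨htt', ht⟩ ⟨rfl, ht'⟩
  · rw [Finset.mem_filter_univ] at hx
    obtain ⟨t, ⟨htx, htb⟩, -⟩ := h.existsUnique x b hx
    exact ⟨t, by rwa [Finset.mem_filter_univ], htx⟩

end GSet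

namespace TambaraFunctor

open GSet

section Values

variable {G : Type u} [Group G] [Finite G] (R : TambaraFunctor.{u, v} G) {X Y : Type u}
  [MulAction G X] [Finite X] [MulAction G Y] [Finite Y]

theorem ext_orbits {a b : R.obj X}
    (h : ∀ (H : Subgroup G) (f : (G ⧸ H) →[G] X), R.res f a = R.res f b) : a = b := by
  refine orbit_induction (G := G) (P := fun X _ _ => ∀ a b : R.obj X,
    (∀ (H : Subgroup G) (f : (G ⧸ H) →[G] X), R.res f a = R.res f b) → a = b)
    ?_ ?_ X a b h
  · intro X _ _ _ a b _
    exact Subsingleton.elim a b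
  · intro X Y _ _ _ _ H _ i j hij ih a b h
    refine R.ext_sum hij (h H i) (ih _ _ fun K f => ?_)
    rw [← R.res_comp, ← R.res_comp, h]

/-- The value in `R(G/e)` of an element of `R(X)` at a point of `X`. -/
def ev (x : X) : R.obj X →+* R.level ⊥ := R.res (pt x)

theorem ev_res (f : X →[G] Y) (x : X) (a : R.obj Y) : R.ev x (R.res f a) = R.ev (f x) a := by
  rw [ev, ev, ← R.res_comp, comp_pt]

theorem ev_one (a : R.level ⊥) : R.ev ((1 : G) : FreeOrbit G) a = a := by
  have pt_eq_id : pt ((1 : G) : FreeOrbit G) = MulActionHom.id G :=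
    hom_ext_of_apply_eq ((1 : G) : FreeOrbit G) (pt_one _)
  rw [ev, pt_eq_id, R.res_id]

theorem ev_smul (g : G) (x : X) (a : R.obj X) : R.ev (g • x) a = R.conj g (R.ev x a) := by
  rw [ev, pt_smul, R.res_comp]
  rfl

theorem ext_free [IsCancelSMul G X] {a b : R.obj X} (h : ∀ x, R.ev x a = R.ev x b) : a = b := by
  refine R.ext_orbits fun H f => ?_
  obtain rfl : H = ⊥ := le_bot_iff.1 <| (le_stabilizer_apply_one f).trans_eq
    (IsCancelSMul.stabilizer_eq_bot _)
  rw [eq_pt f]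
  exact h _

theorem ev_nm_of_injective {f : X →[G] Y} (hf : Function.Injective f) (x : X) (a : R.obj X) :
    R.ev (f x) (R.nm f a) = R.ev x a := by
  rw [← R.ev_res, R.res_nm_of_injective f hf]

theorem ev_tr_of_injective {f : X →[G] Y} (hf : Function.Injective f) (x : X) (a : R.obj X) :
    R.ev (f x) (R.tr f a) = R.ev x a := by
  rw [← R.ev_res, R.res_tr_of_injective f hf]

theorem ev_tr_of_notMem_range {f : X →[G] Y} {y : Y} (hy : y ∉ Set.range f) (a : R.obj X) :
    R.ev y (R.tr f a) = 0 := by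
  refine R.res_tr_of_disjoint f (pt y) (fun x b hxb => hy ?_) a
  obtain ⟨g, rfl⟩ := QuotientGroup.mk_surjective b
  exact ⟨g⁻¹ • x, by rw [map_smul, hxb, pt_mk, inv_smul_smul]⟩

-- Over `G/e`, every orbit maps isomorphically.
theorem ev_nm_freeOrbit [Fintype X] [DecidableEq (FreeOrbit G)]
    (f : X →[G] FreeOrbit G) (y : FreeOrbit G) (a : R.obj X) :
    R.ev y (R.nm f a) = ∏ x with f x = y, R.ev x a := by
  refine orbit_induction (G := G) (P := fun X _ _ => ∀ [Fintype X]
    (f : X →[G] FreeOrbit G) (a : R.obj X),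
    R.ev y (R.nm f a) = ∏ x with f x = y, R.ev x a) ?_ ?_ X f a
  · intro X _ _ _ _ f a
    rw [Subsingleton.elim a 1, map_one, map_one, Finset.univ_eq_empty, Finset.filter_empty,
      Finset.prod_empty]
  · intro X X' _ _ _ _ H _ i j hij ih _ f a
    classical
    have := Fintype.ofFinite (G ⧸ H)
    have := Fintype.ofFinite X'
    have fi_injective := injective_of_isCancelSMul (f.comp i)
    obtain ⟨x, rfl⟩ := surjective_of_isPretransitive (f.comp i) y
    have fi_eq : ∀ x', f (i x') = f (i x) ↔ x' = x := fun x' =>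
      fi_injective.eq_iff
    rw [R.nm_eq_mul hij, map_mul, R.ev_nm_of_injective fi_injective, ih, Finset.prod_filter,
      Finset.prod_filter, ← (Equiv.ofBijective _ hij).prod_comp, Fintype.prod_sum_type]
    simp only [R.ev_res, Equiv.ofBijective_apply, Sum.elim_inl, Sum.elim_inr,
      MulActionHom.comp_apply, fi_eq, Finset.prod_ite_eq', Finset.mem_univ, if_true]

theorem ev_nm [Fintype X] [DecidableEq Y] (f : X →[G] Y) (y : Y) (a : R.obj X) :
    R.ev y (R.nm f a) = ∏ x with f x = y, R.ev x a := by
  classical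
  obtain ⟨E, _, _, u, v, h⟩ := exists_isPullbackSquare f (pt y)
  have := Fintype.ofFinite E
  calc R.ev y (R.nm f a) = R.nm v (R.res u a) := R.res_nm h a
    _ = ∏ t with v t = ((1 : G) : FreeOrbit G), R.ev (u t) a := by
      rw [← R.ev_one (R.nm v _), R.ev_nm_freeOrbit]
      simp only [R.ev_res]
    _ = ∏ x with f x = y, R.ev x a := by
      rw [prod_fiber_eq_of_isPullbackSquare h fun x => R.ev x a, pt_one]

theorem ev_nm_of_isIdempotentElem {f : X →[G] Y} {y : Y} {e : R.level ⊥} (he : IsIdempotentElem e)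
    {a : R.obj X} (ha : ∀ x, f x = y → R.ev x a = e) (hy : y ∈ Set.range f) :
    R.ev y (R.nm f a) = e := by
  classical
  have := Fintype.ofFinite X
  obtain ⟨x, hx⟩ := hy
  rw [R.ev_nm, Finset.prod_congr rfl fun x hx => ha x ((Finset.mem_filter_univ x).1 hx),
    Finset.prod_const, he.pow_eq (Finset.card_ne_zero_of_mem ((Finset.mem_filter_univ x).2 hx))]

theorem ev_mul_nm_res (f : X →[G] Y) {a : R.obj Y} (ha : IsIdempotentElem a) (y : Y) :
    R.ev y (a * R.nm f (R.res f a)) = R.ev y a := by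
  classical
  have := Fintype.ofFinite X
  rw [map_mul, R.ev_nm, Finset.prod_congr rfl fun x hx => by
    rw [R.ev_res, (Finset.mem_filter_univ x).1 hx], Finset.prod_const, ← pow_succ',
    (ha.map (R.ev y)).pow_succ_eq]

end Values

end TambaraFunctor

namespace GSet

variable {G : Type u} [Group G] {X Y T : Type u} [MulAction G X] [MulAction G Y] [MulAction G T]

/-- The map `id × f` on products with `G/e`. -/
def freeMap (f : X →[G] Y) : (FreeOrbit G × X) →[G] (FreeOrbit G × Y) :=
  (MulActionHom.id G).prodMap f

variable (G X) in
/-- The projection `G/e × X → X`. -/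
def freeProj : (FreeOrbit G × X) →[G] X := MulActionHom.snd G (FreeOrbit G) X

theorem freeProj_surjective : Function.Surjective (freeProj G X) :=
  fun x => ⟨(((1 : G) : FreeOrbit G), x), rfl⟩

theorem isPullbackSquare_freeMap (f : X →[G] Y) :
    IsPullbackSquare (freeMap f) (freeProj G X) (freeProj G Y) f := by
  refine ⟨fun _ => rfl, fun x b h => ⟨(x.1, b), ⟨Prod.ext rfl h.symm, rfl⟩, ?_⟩⟩
  rintro t ⟨rfl, rfl⟩
  rfl

theorem isPullbackSquare_freeProj (f : X →[G] Y) :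
    IsPullbackSquare (freeProj G X) (freeMap f) f (freeProj G Y) := by
  refine ⟨fun _ => rfl, fun x b h => ⟨(b.1, x), ⟨rfl, Prod.ext rfl h⟩, ?_⟩⟩
  rintro t ⟨rfl, rfl⟩
  rfl

/-- Right multiplication by `g` on the first factor of `G/e × X`. -/
def twist (X : Type u) [MulAction G X] (g : G) : (FreeOrbit G × X) →[G] (FreeOrbit G × X) :=
  (TambaraFunctor.rightMul g).prodMap (MulActionHom.id G)

theorem twist_injective (g : G) : Function.Injective (twist X g) :=
  Function.Injective.prodMap (mul_left_injective (g : FreeOrbit G)) Function.injective_id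

theorem isPullbackSquare_twist [Finite G] [Finite X] (g : G) :
    IsPullbackSquare (twist X g) (freeProj G X) (freeProj G X) (MulActionHom.id G) := by
  refine ⟨fun _ => rfl, fun x b h => ?_⟩
  obtain ⟨t, rfl⟩ := Finite.surjective_of_injective (twist_injective g) x
  exact ⟨t, ⟨rfl, h⟩, fun t' ht => twist_injective g ht.1⟩

theorem prod_twist [Fintype G] [Fintype X] [DecidableEq X] {M : Type*} [CommMonoid M]
    (F : FreeOrbit G × X → M) (x : FreeOrbit G × X) [Fintype (FreeOrbit G)] :
    ∏ g, F (twist X g x) = ∏ z with freeProj G X z = freeProj G X x, F z := by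
  refine Finset.prod_bij (fun g _ => twist X g x) (fun g _ => ?_) (fun g _ k _ h => ?_)
    (fun z hz => ?_) fun _ _ => rfl
  · exact (Finset.mem_filter_univ _).2 rfl
  · have h : (g : FreeOrbit G) = k := mul_left_cancel (congrArg Prod.fst h)
    simpa [inv_mul_eq_one] using QuotientGroup.eq.1 h
  · obtain ⟨g, hg⟩ := QuotientGroup.mk_surjective (x.1⁻¹ * z.1)
    refine ⟨g, Finset.mem_univ g, Prod.ext ?_ ((Finset.mem_filter_univ z).1 hz).symm⟩
    exact (congrArg (x.1 * ·) hg).trans (mul_inv_cancel_left _ _)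

end GSet

namespace TambaraFunctor

open GSet

section IsFreeNorm

variable {G : Type u} [Group G] [Finite G] {R : TambaraFunctor.{u, v} G} {X Y : Type u}
  [MulAction G X] [Finite X] [MulAction G Y] [Finite Y]

/-- The elements of `R(X)` that are the norm, along `G/e × X → X`, of their own restriction. Unlike
arbitrary elements, they are determined by their values at the points of `X`. -/
def IsFreeNorm (a : R.obj X) : Prop := R.nm (freeProj G X) (R.res (freeProj G X) a) = a

namespace IsFreeNorm

theorem ext {a b : R.obj X} (ha : IsFreeNorm a) (hb : IsFreeNorm b)
    (h : ∀ x, R.ev x a = R.ev x b) : a = b := by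
  have : R.res (freeProj G X) a = R.res (freeProj G X) b :=
    R.ext_free fun x => by rw [R.ev_res, R.ev_res, h]
  rw [← ha, ← hb, this]

theorem zero : IsFreeNorm (0 : R.obj X) := by
  rw [IsFreeNorm, map_zero, R.nm_zero_of_surjective _ freeProj_surjective]

theorem mul {a b : R.obj X} (ha : IsFreeNorm a) (hb : IsFreeNorm b) : IsFreeNorm (a * b) := by
  rw [IsFreeNorm, map_mul, map_mul, ha, hb]

theorem res {a : R.obj Y} (ha : IsFreeNorm a) (f : X →[G] Y) : IsFreeNorm (R.res f a) := by
  have comp_eq : f.comp (freeProj G X) = (freeProj G Y).comp (freeMap f) := rfl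
  rw [IsFreeNorm, ← R.res_comp, comp_eq, R.res_comp, ← R.res_nm (isPullbackSquare_freeMap f), ha]

theorem nm {a : R.obj X} (ha : IsFreeNorm a) (f : X →[G] Y) : IsFreeNorm (R.nm f a) := by
  have comp_eq : (freeProj G Y).comp (freeMap f) = f.comp (freeProj G X) := rfl
  rw [IsFreeNorm, R.res_nm (isPullbackSquare_freeProj f), ← R.nm_comp, comp_eq, R.nm_comp, ha]

end IsFreeNorm

theorem res_nm_freeProj [Fintype G] (a : R.obj (FreeOrbit G × X)) :
    R.res (freeProj G X) (R.nm (freeProj G X) a) = ∏ g, R.res (twist X g) a := by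
  classical
  have := Fintype.ofFinite X
  have := Fintype.ofFinite (FreeOrbit G)
  refine R.ext_free fun x => ?_
  simp only [R.ev_res, R.ev_nm, map_prod]
  exact (prod_twist (fun z => R.ev z a) x).symm

theorem nm_freeProj_res_twist (g : G) (a : R.obj (FreeOrbit G × X)) :
    R.nm (freeProj G X) (R.res (twist X g) a) = R.nm (freeProj G X) a := by
  rw [← R.res_nm (isPullbackSquare_twist g), R.res_id]

theorem isFreeNorm_nm_freeProj {a : R.obj (FreeOrbit G × X)} (ha : IsIdempotentElem a) :
    IsFreeNorm (R.nm (freeProj G X) a) := by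
  have := Fintype.ofFinite G
  rw [IsFreeNorm, res_nm_freeProj, map_prod,
    Finset.prod_congr rfl fun g _ => nm_freeProj_res_twist g a, Finset.prod_const,
    (ha.map (R.nm (freeProj G X))).pow_eq (Finset.card_ne_zero_of_mem (Finset.mem_univ 1))]

end IsFreeNorm

end TambaraFunctor

namespace GSet

section FreeFun

variable {G : Type u} [Group G] {T X Y : Type u} [MulAction G T] [MulAction G X] [MulAction G Y]

/-- The set of all functions `G/e → T`, equivariant or not, with `G` acting by conjugation. It is
the dependent product of `G/e × T → G/e` along the map from `G/e` to the point. -/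
@[ext]
structure FreeFun (G : Type u) [Group G] (T : Type u) where
  toFun : FreeOrbit G → T

namespace FreeFun

instance : MulAction G (FreeFun G T) where
  smul g φ := ⟨fun x => g • φ.toFun (g⁻¹ • x)⟩
  one_smul φ := by
    ext x
    change (1 : G) • φ.toFun ((1 : G)⁻¹ • x) = φ.toFun x
    rw [inv_one, one_smul, one_smul]
  mul_smul g h φ := by
    ext x
    change (g * h) • φ.toFun ((g * h)⁻¹ • x) = g • h • φ.toFun (h⁻¹ • g⁻¹ • x)
    rw [mul_inv_rev, mul_smul, mul_smul]

theorem smul_apply_smul (g : G) (φ : FreeFun G T) (x : FreeOrbit G) :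
    (g • φ).toFun (g • x) = g • φ.toFun x := by
  change g • φ.toFun (g⁻¹ • g • x) = _
  rw [inv_smul_smul]

instance [Finite G] [Finite T] : Finite (FreeFun G T) :=
  Finite.of_injective FreeFun.toFun fun _ _ => FreeFun.ext

/-- Evaluation of functions on `G/e`, as a map over `G/e`. -/
def eval : (FreeOrbit G × FreeFun G T) →[G] (FreeOrbit G × T) where
  toFun x := (x.1, x.2.toFun x.1)
  map_smul' g x := Prod.ext rfl (smul_apply_smul g x.2 x.1)

variable (G T) in
/-- The inclusion of the constant functions. -/
def const : T →[G] FreeFun G T := ⟨fun t => ⟨fun _ => t⟩, fun _ _ => rfl⟩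

theorem const_injective : Function.Injective (const G T) := fun _ _ h =>
  congrFun (congrArg toFun h) ((1 : G) : FreeOrbit G)

end FreeFun

variable (G X) in
/-- The map from `X` to the point. -/
def toPoint : X →[G] PUnit.{u + 1} := ⟨fun _ => PUnit.unit, fun _ _ => rfl⟩

theorem isPullbackSquare_prod_toPoint :
    IsPullbackSquare (MulActionHom.snd G X Y) (MulActionHom.fst G X Y) (toPoint G Y)
      (toPoint G X) := by
  refine ⟨fun _ => rfl, fun y x _ => ⟨(x, y), ⟨rfl, rfl⟩, ?_⟩⟩
  rintro t ⟨rfl, rfl⟩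
  rfl

theorem isExponentialDiagram_freeFun : IsExponentialDiagram (MulActionHom.fst G (FreeOrbit G) T)
    (toPoint G (FreeOrbit G)) FreeFun.eval (freeProj G (FreeFun G T))
    (toPoint G (FreeFun G T)) := by
  refine ⟨⟨fun _ => rfl, fun x b _ => ⟨(x, b), ⟨rfl, rfl⟩, ?_⟩⟩, fun y s hs => ?_⟩
  · rintro t ⟨h1, h2⟩
    exact Prod.ext h1 h2
  · refine ⟨⟨fun x => (s ⟨x, rfl⟩).2⟩, ⟨rfl, ?_⟩, ?_⟩
    · rintro ⟨t, b⟩ ⟨x, hx⟩ rfl h2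
      obtain rfl : t = x := h2
      exact Prod.ext (hs ⟨t, hx⟩).symm rfl
    · rintro b ⟨-, hb⟩
      ext x
      exact congrArg Prod.snd (hb (x, b) ⟨x, rfl⟩ rfl rfl)

end FreeFun

end GSet

namespace TambaraFunctor

open GSet

section TautologicalIdempotent

variable {G : Type u} [Group G] [Finite G] (R : TambaraFunctor.{u, v} G)

/-- A complete system of orthogonal idempotents of `R(G/e)` that is indexed equivariantly by a
finite `G`-set `T`. -/
structure EquivariantIdempotents (T : Type u) [MulAction G T] [Fintype T] where
  toFun : T → R.level ⊥
  map_smul : ∀ (g : G) (t : T), toFun (g • t) = R.conj g (toFun t)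
  complete : CompleteOrthogonalIdempotents toFun

namespace EquivariantIdempotents

variable {R} {T : Type u} [MulAction G T] [Fintype T] (d : R.EquivariantIdempotents T)

/-- The element of `R(G/e × T)` whose value at `(x, t)` is `d t`. -/
def delta : R.obj (FreeOrbit G × T) :=
  ∑ t, R.tr (pt (((1 : G) : FreeOrbit G), t)) (d.toFun t)

theorem ev_delta (x : FreeOrbit G × T) : R.ev x d.delta = d.toFun x.2 := by
  classical
  have ev_base (t s : T) : R.ev (((1 : G) : FreeOrbit G), t)
      (R.tr (pt (((1 : G) : FreeOrbit G), s)) (d.toFun s)) = if t = s then d.toFun s else 0 := by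
    split_ifs with h
    · subst h
      have := R.ev_tr_of_injective (injective_of_isCancelSMul (pt (((1 : G) : FreeOrbit G), t)))
        ((1 : G) : FreeOrbit G) (d.toFun t)
      rwa [pt_one, R.ev_one] at this
    · refine R.ev_tr_of_notMem_range (fun ⟨y, hy⟩ => h ?_) _
      obtain ⟨g, rfl⟩ := QuotientGroup.mk_surjective y
      have g_eq_one : g = 1 := IsCancelSMul.eq_one_of_smul (congrArg Prod.fst hy)
      exact (congrArg Prod.snd hy).symm.trans (by rw [g_eq_one]; exact one_smul G s)
  obtain ⟨x, t⟩ := x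
  obtain ⟨g, rfl⟩ := MulAction.exists_smul_eq G ((1 : G) : FreeOrbit G) x
  have := R.ev_smul g (((1 : G) : FreeOrbit G), g⁻¹ • t) d.delta
  rw [Prod.smul_mk, smul_inv_smul] at this
  rw [this, delta, map_sum, Finset.sum_congr rfl fun s _ => ev_base _ s, Finset.sum_ite_eq,
    if_pos (Finset.mem_univ _), ← d.map_smul, smul_inv_smul]

theorem isIdempotentElem_delta : IsIdempotentElem d.delta :=
  R.ext_free fun x => by rw [map_mul, ev_delta, (d.complete.idem _).eq]

theorem tr_delta : R.tr (MulActionHom.fst G (FreeOrbit G) T) d.delta = 1 := by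
  have fst_comp_pt (t : T) : (MulActionHom.fst G (FreeOrbit G) T).comp
      (pt (((1 : G) : FreeOrbit G), t)) = MulActionHom.id G := by
    rw [comp_pt]
    exact (eq_pt (MulActionHom.id G)).symm
  simp only [delta, map_sum, ← R.tr_comp, fst_comp_pt, R.tr_id, d.complete.complete]

/-- The tautological idempotent of `R(T)`, the norm of `delta`. Its value at `t` is `d t`. -/
def tau : R.obj T := R.nm (freeProj G T) d.delta

theorem isFreeNorm_tau : IsFreeNorm d.tau := isFreeNorm_nm_freeProj d.isIdempotentElem_delta

theorem isIdempotentElem_tau : IsIdempotentElem d.tau := d.isIdempotentElem_delta.map _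

theorem ev_tau (t : T) : R.ev t d.tau = d.toFun t :=
  R.ev_nm_of_isIdempotentElem (d.complete.idem t) (fun x hx => by rw [ev_delta, ← hx]; rfl)
    (freeProj_surjective t)

section

variable {X Y : Type u} [MulAction G X] [Finite X] [MulAction G Y] [Finite Y]

theorem res_tau_mul_res_tau (a b : X →[G] T) (h : ∀ x, a x ≠ b x) :
    R.res a d.tau * R.res b d.tau = 0 := by
  refine ((d.isFreeNorm_tau.res a).mul (d.isFreeNorm_tau.res b)).ext .zero fun x => ?_
  rw [map_mul, R.ev_res, R.ev_res, ev_tau, ev_tau, d.complete.ortho (h x), map_zero]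

theorem res_tau_mul_nm (f : X →[G] Y) (y : Y →[G] T) :
    R.res y d.tau * R.nm f (R.res (y.comp f) d.tau) = R.res y d.tau := by
  have free_y := d.isFreeNorm_tau.res y
  have free_yf := d.isFreeNorm_tau.res (y.comp f)
  refine (free_y.mul (free_yf.nm f)).ext free_y fun x => ?_
  rw [R.res_comp, R.ev_mul_nm_res f (d.isIdempotentElem_tau.map _)]

end

/-- The norm along `G/e × FreeFun G T → FreeFun G T` of the pullback of `delta` under evaluation.
Its value at `φ` is the product of all `d (φ x)`. -/
def prodValues : R.obj (FreeFun G T) :=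
  R.nm (freeProj G (FreeFun G T)) (R.res FreeFun.eval d.delta)

theorem isFreeNorm_prodValues : IsFreeNorm d.prodValues :=
  isFreeNorm_nm_freeProj (d.isIdempotentElem_delta.map _)

theorem ev_res_eval_delta (z : FreeOrbit G × FreeFun G T) :
    R.ev z (R.res FreeFun.eval d.delta) = d.toFun (z.2.toFun z.1) := by
  rw [R.ev_res, ev_delta]
  rfl

theorem ev_prodValues_eq_zero {φ : FreeFun G T} {x y : FreeOrbit G} (h : φ.toFun x ≠ φ.toFun y) :
    R.ev φ d.prodValues = 0 := by
  classical
  have := Fintype.ofFinite (FreeOrbit G × FreeFun G T)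
  have idem : IsIdempotentElem (R.ev φ d.prodValues) :=
    ((d.isIdempotentElem_delta.map _).map _).map _
  have dvd (z : FreeOrbit G) : d.toFun (φ.toFun z) ∣ R.ev φ d.prodValues := by
    rw [prodValues, R.ev_nm, ← d.ev_res_eval_delta (z, φ)]
    refine Finset.dvd_prod_of_mem (fun w => R.ev w (R.res FreeFun.eval d.delta)) ?_
    exact (Finset.mem_filter_univ _).2 rfl
  have := mul_dvd_mul (dvd x) (dvd y)
  rwa [d.complete.ortho h, idem.eq, zero_dvd_iff] at this

theorem res_const_prodValues : R.res (FreeFun.const G T) d.prodValues = d.tau := by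
  refine (d.isFreeNorm_prodValues.res _).ext d.isFreeNorm_tau fun t => ?_
  rw [R.ev_res, ev_tau]
  refine R.ev_nm_of_isIdempotentElem (d.complete.idem t) (fun z hz => ?_) (freeProj_surjective _)
  rw [ev_res_eval_delta, show z.2 = FreeFun.const G T t from hz]
  rfl

theorem res_rangeCompl_const_prodValues :
    R.res (rangeCompl (FreeFun.const G T)).subtype d.prodValues = 0 := by
  refine (d.isFreeNorm_prodValues.res _).ext .zero fun φ => ?_
  rw [R.ev_res, map_zero]
  by_contra h
  refine φ.2 ⟨φ.1.toFun ((1 : G) : FreeOrbit G), FreeFun.ext (funext fun x => ?_)⟩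
  by_contra hx
  exact h (d.ev_prodValues_eq_zero hx)

theorem tr_tau : R.tr (toPoint G T) d.tau = 1 := by
  calc R.tr (toPoint G T) d.tau = R.tr (toPoint G (FreeFun G T)) d.prodValues := by
        rw [R.tr_eq_add (bijective_sumElim_rangeCompl FreeFun.const_injective),
          res_const_prodValues, res_rangeCompl_const_prodValues, map_zero, add_zero]
        rfl
    _ = R.nm (toPoint G (FreeOrbit G)) (R.tr (MulActionHom.fst G (FreeOrbit G) T) d.delta) :=
      (R.nm_tr isExponentialDiagram_freeFun d.delta).symm
    _ = 1 := by rw [tr_delta, map_one]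

theorem tr_res_tau (X : Type u) [MulAction G X] [Finite X] :
    R.tr (MulActionHom.fst G X T) (R.res (MulActionHom.snd G X T) d.tau) = 1 := by
  rw [← R.res_tr isPullbackSquare_prod_toPoint, tr_tau, map_one]

end EquivariantIdempotents

end TautologicalIdempotent

end TambaraFunctor

namespace GSet

/-- The induced `G`-set `G ×_H Y`. It is encoded as `G/H × Y`, with the action twisted by the
cocycle of a section of `G → G/H`, so that induction of maps, of pullback squares and of
exponential diagrams can be computed in the second component. -/
@[ext]
structure Induced {G : Type u} [Group G] (H : Subgroup G) (Y : Type u) where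
  coset : G ⧸ H
  point : Y

namespace Induced

variable {G : Type u} [Group G] {H : Subgroup G} {W X Y Z : Type u} [MulAction G W] [MulAction H X]
  [MulAction H Y] [MulAction H Z]

theorem mk_mul_out (g : G) (c : G ⧸ H) : ((g * c.out : G) : G ⧸ H) = g • c := by
  rw [← smul_eq_mul, ← MulAction.Quotient.smul_coe, QuotientGroup.out_eq']

/-- The cocycle `G × G/H → H` of the section `Quotient.out` of `G → G/H`. -/
noncomputable def cocycle (g : G) (c : G ⧸ H) : H :=
  ⟨(g • c).out⁻¹ * (g * c.out), QuotientGroup.eq.1 (by rw [QuotientGroup.out_eq', mk_mul_out])⟩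

theorem cocycle_one (c : G ⧸ H) : cocycle 1 c = 1 := by
  ext
  simp only [cocycle, one_smul, one_mul, inv_mul_cancel, Subgroup.coe_one]

theorem cocycle_mul (g h : G) (c : G ⧸ H) :
    cocycle (g * h) c = cocycle g (h • c) * cocycle h c := by
  ext
  simp only [cocycle, Subgroup.coe_mul, mul_smul]
  group

noncomputable instance : MulAction G (Induced H Y) where
  smul g p := ⟨g • p.coset, cocycle g p.coset • p.point⟩
  one_smul p := by
    refine Induced.ext (one_smul G p.coset) ?_
    change cocycle 1 p.coset • p.point = p.point
    rw [cocycle_one, one_smul]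
  mul_smul g h p := by
    refine Induced.ext (mul_smul g h p.coset) ?_
    change cocycle (g * h) p.coset • p.point = cocycle g (h • p.coset) • cocycle h p.coset • p.point
    rw [cocycle_mul, mul_smul]

instance [Finite G] [Finite Y] : Finite (Induced H Y) :=
  Finite.of_injective (fun p : Induced H Y => (p.coset, p.point)) fun _ _ h =>
    Induced.ext (congrArg Prod.fst h) (congrArg Prod.snd h)

instance [IsCancelSMul H Y] : IsCancelSMul G (Induced H Y) where
  right_cancel' a b p h := by
    have coset_eq : a • p.coset = b • p.coset := congrArg coset h
    have cocycle_eq : cocycle a p.coset = cocycle b p.coset :=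
      IsCancelSMul.right_cancel _ _ p.point (congrArg point h)
    have := congrArg Subtype.val cocycle_eq
    simp only [cocycle, coset_eq] at this
    exact mul_right_cancel (mul_left_cancel this)

section Maps

variable (H) in
/-- The map of induced `G`-sets given by a map of `H`-sets. -/
noncomputable def map (f : X →[H] Y) : Induced H X →[G] Induced H Y where
  toFun p := ⟨p.coset, f p.point⟩
  map_smul' _ _ := Induced.ext rfl (map_smul f _ _)

variable (H Y) in
/-- The projection of an induced `G`-set to `G/H`. -/
noncomputable def proj : Induced H Y →[G] (G ⧸ H) := ⟨coset, fun _ _ => rfl⟩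

theorem map_injective {f : X →[H] Y} (hf : Function.Injective f) : Function.Injective (map H f) :=
  fun _ _ h => Induced.ext (congrArg coset h :) (hf (congrArg point h))

theorem map_surjective {f : X →[H] Y} (hf : Function.Surjective f) :
    Function.Surjective (map H f) := fun p => by
  obtain ⟨x, hx⟩ := hf p.point
  exact ⟨⟨p.coset, x⟩, Induced.ext rfl hx⟩

theorem bijective_sumElim_map {i : X →[H] Z} {j : Y →[H] Z}
    (h : Function.Bijective (Sum.elim i j)) :
    Function.Bijective (Sum.elim (map H i) (map H j)) := by
  obtain ⟨hi, hj, hij⟩ := Sum.elim_injective.1 h.1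
  refine ⟨(map_injective hi).sumElim (map_injective hj) fun x y hxy => hij _ _ (congrArg point hxy),
    fun z => ?_⟩
  obtain ⟨x | y, hx⟩ := h.2 z.point
  · exact ⟨Sum.inl ⟨z.coset, x⟩, Induced.ext rfl hx⟩
  · exact ⟨Sum.inr ⟨z.coset, y⟩, Induced.ext rfl hx⟩

theorem isPullbackSquare_map {E B : Type u} [MulAction H E] [MulAction H B] {u : E →[H] X}
    {v : E →[H] B} {f : X →[H] Y} {q : B →[H] Y} (h : IsPullbackSquare u v f q) :
    IsPullbackSquare (map H u) (map H v) (map H f) (map H q) := by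
  refine ⟨fun t => Induced.ext rfl (h.comm t.point), fun x b hxb => ?_⟩
  obtain ⟨t, ⟨htx, htb⟩, ht⟩ := h.existsUnique x.point b.point (congrArg point hxb)
  refine ⟨⟨x.coset, t⟩, ⟨Induced.ext rfl htx, Induced.ext (congrArg coset hxb :) htb⟩, ?_⟩
  rintro s ⟨rfl, rfl⟩
  exact Induced.ext rfl (ht s.point ⟨rfl, rfl⟩)

theorem isExponentialDiagram_map {A B E : Type u} [MulAction H A] [MulAction H B] [MulAction H E]
    {p : A →[H] X} {f : X →[H] Y} {e : E →[H] A} {f' : E →[H] B} {q : B →[H] Y}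
    (h : IsExponentialDiagram p f e f' q) :
    IsExponentialDiagram (map H p) (map H f) (map H e) (map H f') (map H q) := by
  refine ⟨isPullbackSquare_map h.isPullback, fun y s hs => ?_⟩
  obtain ⟨b, ⟨hby, hbs⟩, hb⟩ := h.existsUnique y.point
    (fun x => (s ⟨⟨y.coset, x.1⟩, Induced.ext rfl x.2⟩).point) fun x =>
      congrArg point (hs ⟨⟨y.coset, x.1⟩, Induced.ext rfl x.2⟩)
  refine ⟨⟨y.coset, b⟩, ⟨Induced.ext rfl hby, ?_⟩, ?_⟩
  · rintro t ⟨x, rfl⟩ ht hx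
    have t_coset : t.coset = x.coset := congrArg coset ht
    exact Induced.ext (t_coset.trans (congrArg coset (hs ⟨x, rfl⟩)).symm)
      (hbs t.point ⟨x.point, rfl⟩ (congrArg point ht) (congrArg point hx))
  · rintro b' ⟨rfl, hb'⟩
    refine Induced.ext rfl (hb b'.point ⟨rfl, fun t x ht hx => ?_⟩)
    exact congrArg point (hb' ⟨b'.coset, t⟩ ⟨⟨b'.coset, x.1⟩, Induced.ext rfl x.2⟩
      (Induced.ext rfl ht) (Induced.ext rfl hx))

end Maps

section Base

variable (H) in
/-- The chosen representative of the base point of `G/H`, which need not be `1`. -/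
noncomputable def outOne : H :=
  ⟨((1 : G) : G ⧸ H).out, by
    simpa only [inv_one, one_mul] using
      QuotientGroup.eq.1 (QuotientGroup.out_eq' ((1 : G) : G ⧸ H)).symm⟩

theorem smul_mk_one (h : H) : (h : G) • ((1 : G) : G ⧸ H) = ((1 : G) : G ⧸ H) := by
  rw [mk_smul_one]
  exact QuotientGroup.eq.2 (by simp)

variable (H Y) in
/-- The inclusion of `Y` as the fibre of `G ×_H Y` over the base point of `G/H`. -/
noncomputable def base : Y →[H] Induced H Y where
  toFun y := ⟨((1 : G) : G ⧸ H), (outOne H)⁻¹ • y⟩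
  map_smul' h y := by
    refine Induced.ext (smul_mk_one h).symm ?_
    change (outOne H)⁻¹ • h • y = cocycle (h : G) ((1 : G) : G ⧸ H) • (outOne H)⁻¹ • y
    rw [smul_smul, smul_smul]
    congr 1
    ext
    simp only [cocycle, outOne, smul_mk_one, Subgroup.coe_mul, Subgroup.coe_inv]
    group

theorem base_injective : Function.Injective (base H Y) := fun _ _ h =>
  MulAction.injective (outOne H)⁻¹ (congrArg point h)

theorem exists_base_eq {p : Induced H Y} (h : p.coset = ((1 : G) : G ⧸ H)) : ∃ y, base H Y y = p :=
  ⟨outOne H • p.point, Induced.ext h.symm (inv_smul_smul _ _)⟩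

theorem map_base (f : X →[H] Y) (x : X) : map H f (base H X x) = base H Y (f x) :=
  Induced.ext rfl (map_smul f _ _)

theorem out_smul_base (p : Induced H Y) : p.coset.out • base H Y p.point = p := by
  have out_smul_one : p.coset.out • ((1 : G) : G ⧸ H) = p.coset := by
    rw [mk_smul_one, QuotientGroup.out_eq']
  refine Induced.ext out_smul_one ?_
  change cocycle p.coset.out ((1 : G) : G ⧸ H) • (outOne H)⁻¹ • p.point = p.point
  rw [smul_smul]
  convert one_smul H p.point
  ext
  simp only [cocycle, outOne, out_smul_one, Subgroup.coe_mul, Subgroup.coe_inv, Subgroup.coe_one]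
  group

instance [MulAction.IsPretransitive H Y] : MulAction.IsPretransitive G (Induced H Y) where
  exists_smul_eq p q := by
    obtain ⟨h, hpq⟩ := MulAction.exists_smul_eq H p.point q.point
    refine ⟨q.coset.out * (h * p.coset.out⁻¹), ?_⟩
    have inv_out_smul : p.coset.out⁻¹ • p = base H Y p.point := by
      rw [inv_smul_eq_iff, out_smul_base]
    rw [mul_smul, mul_smul, inv_out_smul, ← Subgroup.smul_def, ← map_smul, hpq, out_smul_base]

theorem hom_ext_base {f f' : Induced H Y →[G] W} (h : ∀ y, f (base H Y y) = f' (base H Y y)) :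
    f = f' := by
  ext p
  rw [← out_smul_base p, map_smul, map_smul, h]

/-- The map `G ×_H Y → W` that extends a map of `H`-sets `Y → W`. -/
noncomputable def desc (k : Y →[H] W) : Induced H Y →[G] W where
  toFun p := p.coset.out • k p.point
  map_smul' g p := by
    change (g • p.coset).out • k (cocycle g p.coset • p.point) = g • p.coset.out • k p.point
    rw [map_smul, Subgroup.smul_def, smul_smul, smul_smul]
    simp only [cocycle, mul_inv_cancel_left]

theorem exists_map_eq {f : Induced H X →[G] Induced H Y} (hf : (proj H Y).comp f = proj H X) :
    ∃ k : X →[H] Y, map H k = f := by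
  choose k hk using fun x => exists_base_eq (congrArg (fun q => q (base H X x)) hf)
  refine ⟨⟨k, fun h x => base_injective (H := H) (Y := Y) ?_⟩, hom_ext_base fun x => ?_⟩
  · calc base H Y (k (h • x)) = f (h • base H X x) := by rw [hk, map_smul]
      _ = h • base H Y (k x) := (map_smul f (h : G) _).trans (congrArg (h • ·) (hk x).symm)
      _ = base H Y (h • k x) := (map_smul (base H Y) h (k x)).symm
  · rw [map_base]
    exact hk x

theorem exists_map_eq_or_coset_ne [MulAction.IsPretransitive H X]
    (f : Induced H X →[G] Induced H Y) :
    (∃ k : X →[H] Y, map H k = f) ∨ ∀ p, p.coset ≠ (f p).coset := by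
  by_cases! h : ∃ p, p.coset = (f p).coset
  · obtain ⟨p, hp⟩ := h
    exact .inl (exists_map_eq (hom_ext_of_apply_eq p hp.symm))
  · exact .inr h

end Base

section Fibre

variable {V : Type u} [MulAction G V] (g : Induced H Y →[G] W) (f : V →[G] W)

/-- The `H`-set of pairs `(y, v)` with `g (base y) = f v`. Its induction is the pullback of `f`
along `g`. -/
def fibre : SubMulAction H (Y × V) where
  carrier := {t | g (base H Y t.1) = f t.2}
  smul_mem' h t (ht : g (base H Y t.1) = f t.2) := by
    change g (base H Y (h • t.1)) = f (h • t.2)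
    rw [map_smul, Subgroup.smul_def, Subgroup.smul_def, map_smul, map_smul, ht]

/-- The projection of `fibre g f` to `Y`. -/
def fibreFst : fibre g f →[H] Y := (MulActionHom.fst H Y V).comp (fibre g f).subtype

/-- The map from the induction of `fibre g f` to `V`. -/
noncomputable def fibreSnd : Induced H (fibre g f) →[G] V :=
  desc ((MulActionHom.snd H Y V).comp (fibre g f).subtype)

theorem fibreFst_surjective (hf : Function.Surjective f) : Function.Surjective (fibreFst g f) :=
  fun y => by
    obtain ⟨x, hx⟩ := hf (g (base H Y y))
    exact ⟨⟨(y, x), hx.symm⟩, rfl⟩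

theorem isPullbackSquare_fibre :
    IsPullbackSquare (fibreSnd g f) (map H (fibreFst g f)) f g := by
  refine ⟨fun t => ?_, fun x b h => ?_⟩
  · have t_mem : g (base H Y t.point.1.1) = f t.point.1.2 := t.point.2
    change f (t.coset.out • t.point.1.2) = g ⟨t.coset, t.point.1.1⟩
    rw [map_smul, ← t_mem, ← map_smul]
    exact congrArg g (out_smul_base (⟨t.coset, t.point.1.1⟩ : Induced H Y))
  · have b_mem : g (base H Y b.point) = f (b.coset.out⁻¹ • x) := by
      rw [map_smul, h, ← map_smul]
      congr 1
      rw [eq_inv_smul_iff, out_smul_base]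
    refine ⟨⟨b.coset, ⟨(b.point, b.coset.out⁻¹ • x), b_mem⟩⟩, ⟨smul_inv_smul _ _, rfl⟩, ?_⟩
    rintro ⟨c, ⟨⟨y, x'⟩, hy⟩⟩ ⟨rfl, rfl⟩
    exact Induced.ext rfl (Subtype.ext (Prod.ext rfl (inv_smul_smul _ _).symm))

theorem exists_isPullbackSquare_map [Finite Y] [Finite V] : ∃ (E : Type u) (_ : MulAction H E)
    (_ : Finite E) (u : Induced H E →[G] V) (v : E →[H] Y), IsPullbackSquare u (map H v) f g ∧
      (Function.Surjective f → Function.Surjective v) :=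
  ⟨fibre g f, inferInstance, inferInstance, fibreSnd g f, fibreFst g f,
    isPullbackSquare_fibre g f, fibreFst_surjective g f⟩

end Fibre

end Induced

end GSet

namespace TambaraFunctor

open GSet

section Restrict

variable {G : Type u} [Group G] [Finite G] (R : TambaraFunctor.{u, v} G)

/-- The `H`-Tambara functor underlying a `G`-Tambara functor, `X ↦ R (G ×_H X)`. -/
noncomputable abbrev restrict (H : Subgroup G) : TambaraFunctor.{u, v} H where
  obj X _ _ := R.obj (Induced H X)
  res f := R.res (Induced.map H f)
  tr f := R.tr (Induced.map H f)
  nm f := R.nm (Induced.map H f)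
  res_id _ _ _ a := R.res_id _ a
  tr_id _ _ _ a := R.tr_id _ a
  nm_id _ _ _ a := R.nm_id _ a
  res_comp g f a := R.res_comp (Induced.map H g) (Induced.map H f) a
  tr_comp g f a := R.tr_comp (Induced.map H g) (Induced.map H f) a
  nm_comp g f a := R.nm_comp (Induced.map H g) (Induced.map H f) a
  subsingleton_of_isEmpty X _ _ _ :=
    have : IsEmpty (Induced H X) := ⟨fun p => isEmptyElim p.point⟩
    R.subsingleton_of_isEmpty _
  bijective_of_sum _ _ h := R.bijective_of_sum _ _ (Induced.bijective_sumElim_map h)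
  res_tr h a := R.res_tr (Induced.isPullbackSquare_map h) a
  res_nm h a := R.res_nm (Induced.isPullbackSquare_map h) a
  nm_tr h a := R.nm_tr (Induced.isExponentialDiagram_map h) a

end Restrict

section Corner

variable {G : Type u} [Group G] (R : TambaraFunctor.{u, v} G)

/-- A family of idempotents that is stable under restriction and whose norms are `1` after
multiplication with the family. It cuts out a direct factor of the rings `R X` on which transfers
and, up to multiplication with the idempotent, norms are defined. -/
structure NormIdempotent where
  elem (X : Type u) [MulAction G X] [Finite X] : R.obj X
  res_elem {X Y : Type u} [MulAction G X] [Finite X] [MulAction G Y] [Finite Y] (f : X →[G] Y) :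
    R.res f (elem Y) = elem X
  idem (X : Type u) [MulAction G X] [Finite X] : IsIdempotentElem (elem X)
  elem_mul_nm_elem {X Y : Type u} [MulAction G X] [Finite X] [MulAction G Y] [Finite Y]
    (f : X →[G] Y) : elem Y * R.nm f (elem X) = elem Y

namespace NormIdempotent

variable {R} (N : R.NormIdempotent)
variable {X Y : Type u} [MulAction G X] [Finite X] [MulAction G Y] [Finite Y]

/-- The element of the corner ring given by an element of `R X` that the idempotent fixes. -/
def mkCorner (a : R.obj X) (h : N.elem X * a = a) : (N.idem X).Corner :=
  ⟨a, (Subsemigroup.mem_corner_iff (N.idem X)).2 ⟨h, by rw [mul_comm, h]⟩⟩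

theorem elem_mul_coe (a : (N.idem X).Corner) : N.elem X * a.1 = a.1 :=
  ((Subsemigroup.mem_corner_iff (N.idem X)).1 a.2).1

theorem elem_mul_tr (f : X →[G] Y) (a : R.obj X) :
    N.elem Y * R.tr f a = R.tr f (N.elem X * a) := by
  rw [mul_comm, ← R.tr_mul_res, N.res_elem, mul_comm]

theorem elem_mul_nm (f : X →[G] Y) (a : R.obj X) :
    N.elem Y * R.nm f a = N.elem Y * R.nm f (N.elem X * a) := by
  rw [map_mul, ← mul_assoc, N.elem_mul_nm_elem]

/-- The Tambara functor of corner rings `e R(X)`. -/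
def corner : TambaraFunctor.{u, v} G where
  obj X _ _ := (N.idem X).Corner
  res {X Y} _ _ _ _ f :=
    { toFun := fun a =>
        N.mkCorner (R.res f a.1) (by rw [← N.res_elem f, ← map_mul, N.elem_mul_coe])
      map_one' := Subtype.ext (N.res_elem f)
      map_mul' := fun _ _ => Subtype.ext (map_mul (R.res f) _ _)
      map_zero' := Subtype.ext (map_zero (R.res f))
      map_add' := fun _ _ => Subtype.ext (map_add (R.res f) _ _) }
  tr {X Y} _ _ _ _ f :=
    { toFun := fun a => N.mkCorner (R.tr f a.1) (by rw [N.elem_mul_tr, N.elem_mul_coe])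
      map_zero' := Subtype.ext (map_zero (R.tr f))
      map_add' := fun _ _ => Subtype.ext (map_add (R.tr f) _ _) }
  nm {X Y} _ _ _ _ f :=
    { toFun := fun a => N.mkCorner (N.elem Y * R.nm f a.1) (by rw [← mul_assoc, (N.idem Y).eq])
      map_one' := Subtype.ext (N.elem_mul_nm_elem f)
      map_mul' := fun a b => Subtype.ext (by
        change N.elem Y * R.nm f (a.1 * b.1) = (N.elem Y * R.nm f a.1) * (N.elem Y * R.nm f b.1)
        rw [map_mul, mul_mul_mul_comm, (N.idem Y).eq]) }
  res_id _ _ _ _ := Subtype.ext (R.res_id _ _)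
  tr_id _ _ _ _ := Subtype.ext (R.tr_id _ _)
  nm_id X _ _ a := Subtype.ext (by
    change N.elem X * R.nm _ a.1 = a.1
    rw [R.nm_id, N.elem_mul_coe])
  res_comp _ _ _ := Subtype.ext (R.res_comp _ _ _)
  tr_comp _ _ _ := Subtype.ext (R.tr_comp _ _ _)
  nm_comp {X Y Z} _ _ _ _ _ _ g f a := Subtype.ext (by
    change N.elem Z * R.nm (g.comp f) a.1 = N.elem Z * R.nm g (N.elem Y * R.nm f a.1)
    rw [← N.elem_mul_nm, R.nm_comp])
  subsingleton_of_isEmpty X _ _ _ := ⟨fun _ _ => Subtype.ext (Subsingleton.elim _ _)⟩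
  bijective_of_sum {X Y Z} _ _ _ _ _ _ i j h := by
    constructor
    · intro a b hab
      obtain ⟨res_i, res_j⟩ := Prod.mk.inj hab
      exact Subtype.ext (R.ext_sum h (congrArg Subtype.val res_i) (congrArg Subtype.val res_j))
    · rintro ⟨a, b⟩
      obtain ⟨c, hc⟩ := (R.bijective_of_sum i j h).2 (a.1, b.1)
      obtain ⟨res_i, res_j⟩ := Prod.mk.inj hc
      refine ⟨N.mkCorner c (R.ext_sum h ?_ ?_), Prod.ext (Subtype.ext res_i) (Subtype.ext res_j)⟩
      · rw [map_mul, N.res_elem, res_i, N.elem_mul_coe]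
      · rw [map_mul, N.res_elem, res_j, N.elem_mul_coe]
  res_tr h _ := Subtype.ext (R.res_tr h _)
  res_nm {E X B Y} _ _ _ _ _ _ _ _ u v f q h a := Subtype.ext (by
    change R.res q (N.elem Y * R.nm f a.1) = N.elem B * R.nm v (R.res u a.1)
    rw [map_mul, N.res_elem, R.res_nm h])
  nm_tr {X Y A B E} _ _ _ _ _ _ _ _ _ _ p f e f' q h a := Subtype.ext (by
    change N.elem Y * R.nm f (R.tr p a.1) = R.tr q (N.elem B * R.nm f' (R.res e a.1))
    rw [R.nm_tr h, N.elem_mul_tr])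

/-- The inclusion of the corner, which preserves everything but units and norms. -/
def val : N.corner.obj X →ₙ+* R.obj X where
  toFun a := a.1
  map_mul' _ _ := rfl
  map_zero' := rfl
  map_add' _ _ := rfl

theorem val_injective : Function.Injective (N.val (X := X)) := Subtype.val_injective

theorem elem_mul_val (a : N.corner.obj X) : N.elem X * N.val a = N.val a := N.elem_mul_coe a

theorem val_res (f : X →[G] Y) (a : N.corner.obj Y) :
    N.val (N.corner.res f a) = R.res f (N.val a) := rfl

/-- The projection to the corner, multiplication with the idempotent. -/
def proj : R.obj X →+* N.corner.obj X where
  toFun a := N.mkCorner (N.elem X * a) (by rw [← mul_assoc, (N.idem X).eq])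
  map_one' := Subtype.ext (mul_one (N.elem X))
  map_zero' := Subtype.ext (mul_zero (N.elem X))
  map_add' a b := Subtype.ext (mul_add (N.elem X) a b)
  map_mul' a b := Subtype.ext (by
    change N.elem X * (a * b) = (N.elem X * a) * (N.elem X * b)
    rw [mul_mul_mul_comm, (N.idem X).eq])

theorem val_proj (a : R.obj X) : N.val (N.proj a) = N.elem X * a := rfl

theorem proj_val (a : N.corner.obj X) : N.proj (N.val a) = a := N.val_injective (N.elem_mul_val a)

theorem proj_res (f : X →[G] Y) (a : R.obj Y) :
    N.proj (R.res f a) = N.corner.res f (N.proj a) :=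
  N.val_injective (by rw [val_res, val_proj, val_proj, map_mul, res_elem])

theorem proj_tr (f : X →[G] Y) (a : R.obj X) : N.proj (R.tr f a) = N.corner.tr f (N.proj a) :=
  N.val_injective (N.elem_mul_tr f a)

theorem proj_nm (f : X →[G] Y) (a : R.obj X) : N.proj (R.nm f a) = N.corner.nm f (N.proj a) :=
  N.val_injective (N.elem_mul_nm f a)

end NormIdempotent

end Corner

namespace EquivariantIdempotents

variable {G : Type u} [Group G] [Finite G] {R : TambaraFunctor.{u, v} G}
variable {T : Type u} [MulAction G T] [Fintype T] (d : R.EquivariantIdempotents T)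
variable {H : Subgroup G} (t : (G ⧸ H) →[G] T)

/-- The idempotents of the restriction of `R` to `H` given by pulling back the tautological
idempotent of `R(T)` along an orbit `G/H → T`. -/
noncomputable def normIdempotent : (R.restrict H).NormIdempotent where
  elem X _ _ := R.res (t.comp (Induced.proj H X)) d.tau
  res_elem f := (R.res_comp (t.comp (Induced.proj H _)) (Induced.map H f) d.tau).symm
  idem X _ _ := d.isIdempotentElem_tau.map (R.res (t.comp (Induced.proj H X)))
  elem_mul_nm_elem f := d.res_tau_mul_nm (Induced.map H f) (t.comp (Induced.proj H _))

/-- The direct factor of the restriction of `R` to `H` that belongs to an orbit `G/H → T`. -/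
noncomputable abbrev component : TambaraFunctor.{u, v} H := (d.normIdempotent t).corner

end EquivariantIdempotents

end TambaraFunctor

namespace TambaraFunctor

open GSet

namespace TambaraIdeal

variable {G : Type u} [Group G] [Finite G] {R : TambaraFunctor.{u, v} G}

section OnObj

variable {X Y : Type u} [MulAction G X] [Finite X] [MulAction G Y] [Finite Y]

/-- The ideal of `R X` given by a Tambara ideal, for a finite `G`-set `X` which need not be an
orbit. -/
def onObj (I : R.TambaraIdeal) (X : Type u) [MulAction G X] [Finite X] : Ideal (R.obj X) :=
  ⨅ (H : Subgroup G) (f : (G ⧸ H) →[G] X), (I.carrier H).comap (R.res f)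

variable {I J : R.TambaraIdeal}

theorem mem_onObj {a : R.obj X} : a ∈ I.onObj X ↔
    ∀ (H : Subgroup G) (f : (G ⧸ H) →[G] X), R.res f a ∈ I.carrier H := by
  simp only [onObj, Submodule.mem_iInf, Ideal.mem_comap]

theorem onObj_orbit (H : Subgroup G) : I.onObj (G ⧸ H) = I.carrier H := by
  refine le_antisymm (fun a ha => ?_) fun a ha => mem_onObj.2 fun K f => I.res_mem f ha
  rw [← R.res_id _ a]
  exact mem_onObj.1 ha H (MulActionHom.id G)

theorem res_mem_onObj (f : X →[G] Y) {a : R.obj Y} (ha : a ∈ I.onObj Y) :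
    R.res f a ∈ I.onObj X :=
  mem_onObj.2 fun H k => by
    rw [← R.res_comp]
    exact mem_onObj.1 ha H _

theorem onObj_mono (h : I ≤ J) : I.onObj X ≤ J.onObj X := fun _ ha =>
  mem_onObj.2 fun H f => h H (mem_onObj.1 ha H f)

theorem tr_mem_of_orbit {H : Subgroup G} (f : X →[G] (G ⧸ H)) {a : R.obj X} (ha : a ∈ I.onObj X) :
    R.tr f a ∈ I.carrier H := by
  refine orbit_induction (G := G) (P := fun X _ _ => ∀ (f : X →[G] (G ⧸ H)) (a : R.obj X),
    a ∈ I.onObj X → R.tr f a ∈ I.carrier H) ?_ ?_ X f a ha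
  · intro X _ _ _ f a _
    rw [Subsingleton.elim a 0, map_zero]
    exact zero_mem _
  · intro X Y _ _ _ _ K _ i j hij ih f a ha
    rw [R.tr_eq_add hij]
    exact add_mem (I.tr_mem _ (mem_onObj.1 ha K i)) (ih _ _ (res_mem_onObj j ha))

theorem nm_mem_of_orbit [Nonempty X] {H : Subgroup G} (f : X →[G] (G ⧸ H)) {a : R.obj X}
    (ha : a ∈ I.onObj X) : R.nm f a ∈ I.carrier H := by
  obtain ⟨x⟩ := ‹Nonempty X›
  rw [R.nm_eq_mul (bijective_sumElim_rangeCompl (orbitMap_injective (G := G) x))]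
  exact Ideal.mul_mem_right _ _ (I.nm_mem _ (mem_onObj.1 ha _ (orbitMap x le_rfl)))

theorem tr_mem_onObj (f : X →[G] Y) {a : R.obj X} (ha : a ∈ I.onObj X) :
    R.tr f a ∈ I.onObj Y :=
  mem_onObj.2 fun H q => by
    obtain ⟨E, _, _, u, v, hE⟩ := exists_isPullbackSquare f q
    rw [R.res_tr hE]
    exact tr_mem_of_orbit v (res_mem_onObj u ha)

theorem nm_mem_onObj {f : X →[G] Y} (hf : Function.Surjective f) {a : R.obj X}
    (ha : a ∈ I.onObj X) : R.nm f a ∈ I.onObj Y :=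
  mem_onObj.2 fun H q => by
    obtain ⟨E, _, _, u, v, hE⟩ := exists_isPullbackSquare f q
    have : Nonempty E := by
      obtain ⟨x, hx⟩ := hf (q ((1 : G) : G ⧸ H))
      exact (hE.existsUnique x _ hx).exists.nonempty
    rw [R.res_nm hE]
    exact nm_mem_of_orbit v (res_mem_onObj u ha)

end OnObj

section Lattice

theorem mem_sInf {S : Set R.TambaraIdeal} {H : Subgroup G} {a : R.level H} :
    a ∈ (sInf S).carrier H ↔ ∀ I ∈ S, a ∈ I.carrier H := by
  change a ∈ (⨅ I ∈ S, I.carrier H : Ideal (R.level H)) ↔ _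
  simp only [Submodule.mem_iInf]

instance : CompleteLattice R.TambaraIdeal where
  __ := completeLatticeOfInf R.TambaraIdeal fun _ =>
    ⟨fun I hI _ _ ha => mem_sInf.1 ha I hI, fun _ hJ H _ ha => mem_sInf.2 fun _ hI => hJ hI H ha⟩
  top := ⊤
  le_top _ _ _ _ := Submodule.mem_top

variable {I J P : R.TambaraIdeal}

theorem mul_le_iff : I * J ≤ P ↔
    ∀ H : Subgroup G, ∀ a ∈ I.carrier H, ∀ b ∈ J.carrier H, a * b ∈ P.carrier H :=
  ⟨fun h H a ha b hb => h H (mem_sInf.2 fun _ hL => hL H a ha b hb), fun h => sInf_le h⟩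

theorem mul_mem_onObj_mul {X : Type u} [MulAction G X] [Finite X] {a b : R.obj X}
    (ha : a ∈ I.onObj X) (hb : b ∈ J.onObj X) : a * b ∈ (I * J).onObj X :=
  mem_onObj.2 fun H f => by
    rw [map_mul]
    exact mul_le_iff.1 le_rfl H _ (mem_onObj.1 ha H f) _ (mem_onObj.1 hb H f)

theorem mul_le_inf : I * J ≤ I ⊓ J :=
  le_inf (mul_le_iff.2 fun _ _ ha _ _ => Ideal.mul_mem_right _ _ ha)
    (mul_le_iff.2 fun _ _ _ _ hb => Ideal.mul_mem_left _ _ hb)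

theorem IsPrime.infPrime (hP : P.IsPrime) : InfPrime P :=
  ⟨fun h => hP.ne_top (isMax_iff_eq_top.1 h), fun I J h => hP.le_or_le I J (mul_le_inf.trans h)⟩

theorem IsPrime.exists_le_of_iInf_le (hP : P.IsPrime) {ι : Type*} [Finite ι]
    {I : ι → R.TambaraIdeal} (h : ⨅ i, I i ≤ P) : ∃ i, I i ≤ P := by
  have := Fintype.ofFinite ι
  rw [← Finset.inf_univ_eq_iInf, hP.infPrime.finset_inf_le] at h
  obtain ⟨i, -, hi⟩ := h
  exact ⟨i, hi⟩

end Lattice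

end TambaraIdeal

end TambaraFunctor

namespace TambaraFunctor

open GSet

variable {G : Type u} [Group G] [Finite G] {R : TambaraFunctor.{u, v} G}

namespace TambaraIdeal

variable {H : Subgroup G}

variable (H) in
/-- The ideal of the restriction of `R` to `H` given by a Tambara ideal of `R`. -/
noncomputable def restrict (I : R.TambaraIdeal) : (R.restrict H).TambaraIdeal where
  carrier K := I.onObj (Induced H (H ⧸ K))
  tr_mem f _ ha := tr_mem_onObj (Induced.map H f) ha
  nm_mem f _ ha :=
    nm_mem_onObj (Induced.map_surjective (surjective_of_isPretransitive f)) ha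
  res_mem f _ ha := res_mem_onObj (Induced.map H f) ha

theorem onObj_restrict (I : R.TambaraIdeal) (X : Type u) [MulAction H X] [Finite X] :
    (I.restrict H).onObj X = I.onObj (Induced H X) := by
  refine le_antisymm (fun a ha => mem_onObj.2 fun L f => ?_) fun a ha =>
    mem_onObj.2 fun K f => res_mem_onObj (Induced.map H f) ha
  obtain ⟨c, x, hf⟩ : ∃ c x, f ((1 : G) : G ⧸ L) = ⟨c, x⟩ := ⟨_, _, rfl⟩
  let i := orbitMap (H := MulAction.stabilizer H x) x le_rfl
  have map_i : Induced.map H i ⟨c, ((1 : H) : H ⧸ _)⟩ = f ((1 : G) : G ⧸ L) := by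
    rw [hf]
    exact Induced.ext rfl (one_smul H x)
  obtain ⟨k, hk⟩ := exists_comp_eq_of_isPretransitive f (Induced.map H i)
    (Induced.map_injective (orbitMap_injective x)) map_i
  rw [← hk, R.res_comp]
  exact mem_onObj.1 (mem_onObj.1 ha _ i) L k

/-- The right adjoint of `restrict`. -/
noncomputable def coinduce (J : (R.restrict H).TambaraIdeal) : R.TambaraIdeal where
  carrier L := ⨅ (K : Subgroup H) (f : Induced H (H ⧸ K) →[G] (G ⧸ L)),
    (J.carrier K).comap (R.res f)
  tr_mem f a ha := by
    simp only [Submodule.mem_iInf, Ideal.mem_comap] at ha ⊢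
    intro K g
    obtain ⟨E, _, _, u, v, hE, -⟩ := Induced.exists_isPullbackSquare_map g f
    rw [R.res_tr hE]
    refine tr_mem_of_orbit v (mem_onObj.2 fun K' k => ?_)
    rw [← R.res_comp]
    exact ha K' _
  nm_mem f a ha := by
    simp only [Submodule.mem_iInf, Ideal.mem_comap] at ha ⊢
    intro K g
    obtain ⟨E, _, _, u, v, hE, hv⟩ := Induced.exists_isPullbackSquare_map g f
    rw [R.res_nm hE, ← onObj_orbit]
    refine nm_mem_onObj (hv (surjective_of_isPretransitive f)) (mem_onObj.2 fun K' k => ?_)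
    rw [← R.res_comp]
    exact ha K' _
  res_mem f a ha := by
    simp only [Submodule.mem_iInf, Ideal.mem_comap] at ha ⊢
    intro K g
    rw [← R.res_comp]
    exact ha K _

theorem mem_coinduce {J : (R.restrict H).TambaraIdeal} {L : Subgroup G} {a : R.level L} :
    a ∈ J.coinduce.carrier L ↔
      ∀ (K : Subgroup H) (f : Induced H (H ⧸ K) →[G] (G ⧸ L)), R.res f a ∈ J.carrier K := by
  simp only [coinduce, Submodule.mem_iInf, Ideal.mem_comap]

theorem mem_onObj_coinduce {J : (R.restrict H).TambaraIdeal} {X : Type u} [MulAction G X]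
    [Finite X] {a : R.obj X} : a ∈ J.coinduce.onObj X ↔
      ∀ (K : Subgroup H) (f : Induced H (H ⧸ K) →[G] X), R.res f a ∈ J.carrier K := by
  refine ⟨fun ha K f => ?_, fun ha => mem_onObj.2 fun L f => mem_coinduce.2 fun K g => ?_⟩
  · let p := Induced.base H (H ⧸ K) ((1 : H) : H ⧸ K)
    let i := orbitMap (H := MulAction.stabilizer G (f p)) (f p) le_rfl
    obtain ⟨k, hk⟩ := exists_comp_eq_of_isPretransitive f i (orbitMap_injective (f p))
      (x := p) (y := ((1 : G) : G ⧸ _)) (one_smul G (f p))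
    rw [← hk, R.res_comp]
    exact mem_coinduce.1 (mem_onObj.1 ha _ i) K k
  · rw [← R.res_comp]
    exact ha K _

theorem gc_restrict_coinduce :
    GaloisConnection (restrict (R := R) H) (coinduce (R := R) (H := H)) := fun I J => by
  refine ⟨fun h L a ha => mem_coinduce.2 fun K f => ?_, fun h K a ha => ?_⟩
  · exact h K (res_mem_onObj f (onObj_orbit (R := R) L ▸ ha))
  · rw [← R.res_id _ a]
    exact mem_onObj_coinduce.1 (onObj_mono h ha) K (MulActionHom.id G)

end TambaraIdeal

end TambaraFunctor

namespace TambaraFunctor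

open GSet

namespace NormIdempotent

variable {G : Type u} [Group G] [Finite G] {R : TambaraFunctor.{u, v} G} (N : R.NormIdempotent)
variable {X : Type u} [MulAction G X] [Finite X]

/-- The elements of the corner that lie in a Tambara ideal of `R`. -/
def restrictIdeal (I : R.TambaraIdeal) : N.corner.TambaraIdeal where
  carrier K :=
    { carrier := N.val ⁻¹' (I.carrier K)
      add_mem' := fun ha hb => add_mem (S := Ideal (R.level K)) ha hb
      zero_mem' := zero_mem (I.carrier K)
      smul_mem' := fun c _ ha => Ideal.mul_mem_left _ (N.val c) ha }
  tr_mem f _ ha := I.tr_mem f ha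
  nm_mem f _ ha := Ideal.mul_mem_left _ _ (I.nm_mem f ha)
  res_mem f _ ha := I.res_mem f ha

/-- The elements of `R` whose projection lies in a Tambara ideal of the corner. -/
def extendIdeal (J : N.corner.TambaraIdeal) : R.TambaraIdeal where
  carrier K := (J.carrier K).comap N.proj
  tr_mem f a ha := by
    rw [Ideal.mem_comap, proj_tr]
    exact J.tr_mem f ha
  nm_mem f a ha := by
    rw [Ideal.mem_comap, proj_nm]
    exact J.nm_mem f ha
  res_mem f a ha := by
    rw [Ideal.mem_comap, proj_res]
    exact J.res_mem f ha

theorem mem_restrictIdeal {I : R.TambaraIdeal} {K : Subgroup G} {a : N.corner.level K} :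
    a ∈ (N.restrictIdeal I).carrier K ↔ N.val a ∈ I.carrier K :=
  Iff.rfl

theorem mem_onObj_restrictIdeal {I : R.TambaraIdeal} {a : N.corner.obj X} :
    a ∈ (N.restrictIdeal I).onObj X ↔ N.val a ∈ I.onObj X := by
  simp only [TambaraIdeal.mem_onObj, mem_restrictIdeal, val_res]

theorem gc_restrictIdeal_extendIdeal : GaloisConnection N.restrictIdeal N.extendIdeal := fun _ _ =>
  ⟨fun h K _ ha => h K (Ideal.mul_mem_left _ (N.elem (G ⧸ K)) ha), fun h K a ha =>
    N.proj_val a ▸ h K ha⟩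

end NormIdempotent

namespace EquivariantIdempotents

variable {G : Type u} [Group G] [Finite G] {R : TambaraFunctor.{u, v} G}
variable {T : Type u} [MulAction G T] [Fintype T] (d : R.EquivariantIdempotents T)
variable {H K : Subgroup G} (t : (G ⧸ H) →[G] T) (s : (G ⧸ K) →[G] T)

/-- The Tambara ideal of a component given by a Tambara ideal of `R`. -/
noncomputable def restrictIdeal (I : R.TambaraIdeal) : (d.component t).TambaraIdeal :=
  (d.normIdempotent t).restrictIdeal (I.restrict H)

/-- The right adjoint of `restrictIdeal`. -/
noncomputable def extendIdeal (J : (d.component t).TambaraIdeal) : R.TambaraIdeal :=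
  ((d.normIdempotent t).extendIdeal J).coinduce

theorem gc_restrictIdeal_extendIdeal :
    GaloisConnection (d.restrictIdeal t) (d.extendIdeal t) :=
  TambaraIdeal.gc_restrict_coinduce.compose (d.normIdempotent t).gc_restrictIdeal_extendIdeal

section

variable {X : Type u} [MulAction G X] [Finite X] {Y : Type u} [MulAction H Y] [Finite Y]
variable {Z : Type u} [MulAction K Z] [Finite Z]

theorem mem_onObj_restrictIdeal {I : R.TambaraIdeal} {a : (d.component t).obj Y} :
    a ∈ (d.restrictIdeal t I).onObj Y ↔ (d.normIdempotent t).val a ∈ I.onObj (Induced H Y) := by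
  rw [← TambaraIdeal.onObj_restrict]
  exact (d.normIdempotent t).mem_onObj_restrictIdeal

theorem mem_onObj_extendIdeal {J : (d.component t).TambaraIdeal} {a : R.obj X} :
    a ∈ (d.extendIdeal t J).onObj X ↔ ∀ (L : Subgroup H) (f : Induced H (H ⧸ L) →[G] X),
      (d.normIdempotent t).proj (R.res f a) ∈ J.carrier L :=
  TambaraIdeal.mem_onObj_coinduce

theorem proj_res_mem_onObj {J : (d.component t).TambaraIdeal} {a : R.obj X}
    (ha : a ∈ (d.extendIdeal t J).onObj X) (f : Induced H Y →[G] X) :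
    (d.normIdempotent t).proj (R.res f a) ∈ J.onObj Y :=
  TambaraIdeal.mem_onObj.2 fun L k => by
    rw [← NormIdempotent.proj_res, ← R.res_comp]
    exact (d.mem_onObj_extendIdeal t).1 ha L _

theorem proj_res_val_eq_zero (f : Induced H Y →[G] Induced K Z)
    (hf : ∀ p, t p.coset ≠ s (f p).coset) (a : (d.component s).obj Z) :
    (d.normIdempotent t).proj (R.res f ((d.normIdempotent s).val a)) = 0 := by
  have elem_mul_elem : (d.normIdempotent t).elem Y * R.res f ((d.normIdempotent s).elem Z) = 0 := by
    change R.res _ d.tau * R.res f (R.res _ d.tau) = 0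
    rw [← R.res_comp]
    exact d.res_tau_mul_res_tau _ _ hf
  refine (d.normIdempotent t).val_injective ?_
  rw [NormIdempotent.val_proj, ← NormIdempotent.elem_mul_val, map_mul, ← mul_assoc, elem_mul_elem,
    zero_mul, map_zero]

end

theorem restrictIdeal_extendIdeal (ht : Function.Injective t) (J : (d.component t).TambaraIdeal) :
    d.restrictIdeal t (d.extendIdeal t J) = J := by
  refine le_antisymm ((d.gc_restrictIdeal_extendIdeal t).l_u_le J) fun L a ha => ?_
  rw [← TambaraIdeal.onObj_orbit, mem_onObj_restrictIdeal, mem_onObj_extendIdeal]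
  intro L' f
  obtain ⟨k, rfl⟩ | hf := Induced.exists_map_eq_or_coset_ne f
  · rw [← (d.normIdempotent t).val_res, NormIdempotent.proj_val]
    exact J.res_mem k ha
  · rw [d.proj_res_val_eq_zero t t f fun p => ht.ne (hf p)]
    exact zero_mem _

theorem restrictIdeal_extendIdeal_of_disjoint (h : ∀ x y, t x ≠ s y)
    (J : (d.component s).TambaraIdeal) : d.restrictIdeal t (d.extendIdeal s J) = ⊤ := by
  refine eq_top_iff.2 fun L a _ => ?_
  rw [← TambaraIdeal.onObj_orbit, mem_onObj_restrictIdeal, mem_onObj_extendIdeal]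
  intro L' f
  rw [d.proj_res_val_eq_zero s t f fun p => (h _ _).symm]
  exact zero_mem _

theorem restrictIdeal_mul_le (I J : R.TambaraIdeal) :
    d.restrictIdeal t I * d.restrictIdeal t J ≤ d.restrictIdeal t (I * J) := by
  refine TambaraIdeal.mul_le_iff.2 fun L a ha b hb => ?_
  rw [← TambaraIdeal.onObj_orbit, mem_onObj_restrictIdeal] at ha hb ⊢
  rw [map_mul]
  exact TambaraIdeal.mul_mem_onObj_mul ha hb

theorem extendIdeal_mul_le (I J : (d.component t).TambaraIdeal) :
    d.extendIdeal t I * d.extendIdeal t J ≤ d.extendIdeal t (I * J) := by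
  refine TambaraIdeal.mul_le_iff.2 fun L a ha b hb => ?_
  rw [← TambaraIdeal.onObj_orbit, mem_onObj_extendIdeal] at ha hb ⊢
  intro M f
  rw [map_mul, map_mul]
  exact TambaraIdeal.mul_le_iff.1 le_rfl M _ (ha M f) _ (hb M f)

end EquivariantIdempotents

end TambaraFunctor

namespace GSet.Induced

variable {G : Type u} [Group G] {H : Subgroup G} {X T : Type u} [MulAction G X] [MulAction G T]

variable (X) in
/-- The embedding of `G ×_H X ≅ G/H × X` into `X × T` given by an embedding of `G/H` into `T`. -/
noncomputable def toProd (t : (G ⧸ H) →[G] T) : Induced H X →[G] X × T :=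
  (desc (MulActionHom.id H)).prod (t.comp (proj H X))

theorem toProd_injective {t : (G ⧸ H) →[G] T} (ht : Function.Injective t) :
    Function.Injective (toProd X t) := fun p q h => by
  have coset_eq : p.coset = q.coset := ht (congrArg Prod.snd h)
  have smul_eq : p.coset.out • p.point = q.coset.out • q.point := congrArg Prod.fst h
  rw [coset_eq] at smul_eq
  exact Induced.ext coset_eq (MulAction.injective _ smul_eq)

theorem toProd_mk (t : (G ⧸ H) →[G] T) (c : G ⧸ H) (x : X) :
    toProd X t ⟨c, c.out⁻¹ • x⟩ = (x, t c) :=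
  Prod.ext (smul_inv_smul c.out x) rfl

end GSet.Induced

namespace TambaraFunctor.EquivariantIdempotents

open GSet

variable {G : Type u} [Group G] [Finite G] {R : TambaraFunctor.{u, v} G}
variable {T : Type u} [MulAction G T] [Fintype T] (d : R.EquivariantIdempotents T)

theorem res_toProd_mem_onObj {H : Subgroup G} (t : (G ⧸ H) →[G] T) {I : R.TambaraIdeal}
    {X : Type u} [MulAction G X] [Finite X] {a : R.obj X}
    (ha : a ∈ (d.extendIdeal t (d.restrictIdeal t I)).onObj X) :
    R.res (Induced.toProd X t)
      (R.res (MulActionHom.snd G X T) d.tau * R.res (MulActionHom.fst G X T) a) ∈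
        I.onObj (Induced H X) := by
  rw [map_mul, ← R.res_comp, ← R.res_comp]
  exact (d.mem_onObj_restrictIdeal t).1 (d.proj_res_mem_onObj t ha _)

variable {ι : Type*} {H : ι → Subgroup G} {t : ∀ i, (G ⧸ H i) →[G] T}

theorem res_tau_mul_res_mem_onObj (ht : ∀ i, Function.Injective (t i))
    (covering : ∀ s, ∃ i c, t i c = s) {I : R.TambaraIdeal} {X : Type u} [MulAction G X] [Finite X]
    {a : R.obj X} (ha : ∀ i, a ∈ (d.extendIdeal (t i) (d.restrictIdeal (t i) I)).onObj X) :
    R.res (MulActionHom.snd G X T) d.tau * R.res (MulActionHom.fst G X T) a ∈ I.onObj (X × T) := by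
  refine TambaraIdeal.mem_onObj.2 fun M f => ?_
  obtain ⟨i, c, hc⟩ := covering (f ((1 : G) : G ⧸ M)).2
  obtain ⟨k, hk⟩ := exists_comp_eq_of_isPretransitive f (Induced.toProd X (t i))
    (Induced.toProd_injective (ht i)) (x := ((1 : G) : G ⧸ M))
    ((Induced.toProd_mk (t i) c _).trans (Prod.ext rfl hc))
  rw [← hk, R.res_comp]
  exact TambaraIdeal.mem_onObj.1 (d.res_toProd_mem_onObj (t i) (ha i)) M k

theorem iInf_extendIdeal_restrictIdeal_le (ht : ∀ i, Function.Injective (t i))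
    (covering : ∀ s, ∃ i c, t i c = s) (I : R.TambaraIdeal) :
    ⨅ i, d.extendIdeal (t i) (d.restrictIdeal (t i) I) ≤ I := by
  intro L a ha
  have a_mem (i : ι) : a ∈ (d.extendIdeal (t i) (d.restrictIdeal (t i) I)).onObj (G ⧸ L) := by
    rw [TambaraIdeal.onObj_orbit]
    exact iInf_le (fun i => d.extendIdeal (t i) (d.restrictIdeal (t i) I)) i L ha
  have tr_eq : R.tr (MulActionHom.fst G (G ⧸ L) T) (R.res (MulActionHom.snd G (G ⧸ L) T) d.tau *
      R.res (MulActionHom.fst G (G ⧸ L) T) a) = a := by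
    rw [R.tr_mul_res, d.tr_res_tau, one_mul]
  rw [← TambaraIdeal.onObj_orbit, ← tr_eq]
  exact TambaraIdeal.tr_mem_onObj _ (d.res_tau_mul_res_mem_onObj ht covering a_mem)

end TambaraFunctor.EquivariantIdempotents

theorem isClosedMap_sigma_of_finite {ι Y : Type*} {X : ι → Type*} [Finite ι]
    [∀ i, TopologicalSpace (X i)] [TopologicalSpace Y] {f : (Σ i, X i) → Y}
    (hf : ∀ i, IsClosedMap fun x => f ⟨i, x⟩) : IsClosedMap f := fun C hC => by
  have image_eq : f '' C = ⋃ i, (fun x => f ⟨i, x⟩) '' (Sigma.mk i ⁻¹' C) := by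
    ext y
    simp only [Set.mem_iUnion, Set.mem_image, Set.mem_preimage, Sigma.exists]
  rw [image_eq]
  exact isClosed_iUnion_of_finite fun i => hf i _ (hC.preimage continuous_sigmaMk)

namespace TambaraFunctor

namespace NakaokaSpectrum

variable {G : Type u} [Group G] [Finite G] {R : TambaraFunctor.{u, v} G}

theorem ideal_injective : Function.Injective (ideal : R.NakaokaSpectrum → R.TambaraIdeal) := by
  rintro ⟨P, _⟩ ⟨Q, _⟩ rfl
  rfl

theorem isClosed_V (I : R.TambaraIdeal) : IsClosed (V I) :=
  ⟨TopologicalSpace.isOpen_generateFrom_of_mem ⟨I, rfl⟩⟩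

end NakaokaSpectrum

universe u' v'

/-- A reflection of the Tambara ideals of `R` onto those of another Tambara functor `S`, compatible
with products. It embeds the spectrum of `S` into that of `R`. -/
structure IdealReflection {G : Type u} [Group G] [Finite G] (R : TambaraFunctor.{u, v} G)
    {K : Type u'} [Group K] [Finite K] (S : TambaraFunctor.{u', v'} K) where
  restrict : R.TambaraIdeal → S.TambaraIdeal
  extend : S.TambaraIdeal → R.TambaraIdeal
  gc : GaloisConnection restrict extend
  restrict_extend (J : S.TambaraIdeal) : restrict (extend J) = J
  restrict_mul_le (I J : R.TambaraIdeal) : restrict I * restrict J ≤ restrict (I * J)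
  extend_mul_le (I J : S.TambaraIdeal) : extend I * extend J ≤ extend (I * J)

namespace IdealReflection

variable {G : Type u} [Group G] [Finite G] {R : TambaraFunctor.{u, v} G}

section Single

variable {K : Type u'} [Group K] [Finite K] {S : TambaraFunctor.{u', v'} K}
variable (E : R.IdealReflection S)

theorem isPrime_extend_iff {P : S.TambaraIdeal} : (E.extend P).IsPrime ↔ P.IsPrime := by
  refine ⟨fun hP => ⟨?_, fun I J h => ?_⟩, fun hP => ⟨?_, fun I J h => ?_⟩⟩
  · rintro rfl
    exact hP.ne_top E.gc.u_top
  · have := hP.le_or_le _ _ ((E.extend_mul_le I J).trans (E.gc.monotone_u h))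
    rwa [← E.gc.le_iff_le, ← E.gc.le_iff_le, E.restrict_extend, E.restrict_extend] at this
  · intro h
    have := E.restrict_extend ⊤
    rw [E.gc.u_top, ← h, E.restrict_extend] at this
    exact hP.ne_top this
  · rw [← E.gc.le_iff_le, ← E.gc.le_iff_le]
    exact hP.le_or_le _ _ ((E.restrict_mul_le I J).trans (E.gc.l_le h))

/-- The map from the spectrum of `S` to the spectrum of `R`. -/
def spectrumMap (P : S.NakaokaSpectrum) : R.NakaokaSpectrum :=
  ⟨E.extend P.ideal, E.isPrime_extend_iff.2 P.isPrime⟩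

theorem spectrumMap_injective : Function.Injective E.spectrumMap := fun P Q h =>
  NakaokaSpectrum.ideal_injective <| by
    rw [← E.restrict_extend P.ideal, ← E.restrict_extend Q.ideal]
    exact congrArg (fun Q => E.restrict Q.ideal) h

theorem preimage_V (I : R.TambaraIdeal) :
    E.spectrumMap ⁻¹' NakaokaSpectrum.V I = NakaokaSpectrum.V (E.restrict I) :=
  Set.ext fun P => (E.gc I P.ideal).symm

theorem isInducing_spectrumMap : Topology.IsInducing E.spectrumMap := by
  refine ⟨le_antisymm ?_ (le_generateFrom ?_)⟩
  · refine continuous_iff_le_induced.1 (continuous_generateFrom_iff.2 ?_)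
    rintro _ ⟨I, rfl⟩
    rw [Set.preimage_compl, preimage_V]
    exact (NakaokaSpectrum.isClosed_V _).isOpen_compl
  · rintro _ ⟨J, rfl⟩
    rw [← E.restrict_extend J, ← preimage_V, ← Set.preimage_compl]
    exact isOpen_induced (NakaokaSpectrum.isClosed_V _).isOpen_compl

end Single

section Family

variable {ι : Type*} {K : ι → Type u'} [∀ i, Group (K i)] [∀ i, Finite (K i)]
variable {S : ∀ i, TambaraFunctor.{u', v'} (K i)} {E : ∀ i, R.IdealReflection (S i)}

theorem exists_spectrumMap_eq [Finite ι]
    (h : ∀ I, ⨅ i, (E i).extend ((E i).restrict I) ≤ I) (Q : R.NakaokaSpectrum) :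
    ∃ i P, (E i).spectrumMap P = Q := by
  obtain ⟨i, hi⟩ := Q.isPrime.exists_le_of_iInf_le (h Q.ideal)
  have extend_restrict : (E i).extend ((E i).restrict Q.ideal) = Q.ideal :=
    hi.antisymm ((E i).gc.le_u_l Q.ideal)
  refine ⟨i, ⟨(E i).restrict Q.ideal, ?_⟩, NakaokaSpectrum.ideal_injective extend_restrict⟩
  rw [← (E i).isPrime_extend_iff, extend_restrict]
  exact Q.isPrime

variable (disjoint : ∀ i j, i ≠ j → ∀ J, (E j).restrict ((E i).extend J) = ⊤)
include disjoint

theorem eq_of_extend_le_spectrumMap {i j : ι} {J : (S i).TambaraIdeal} {P : (S j).NakaokaSpectrum}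
    (h : (E i).extend J ≤ ((E j).spectrumMap P).ideal) : i = j := by
  by_contra hij
  refine P.isPrime.ne_top (eq_top_iff.2 ?_)
  rw [← disjoint i j hij J]
  exact ((E j).gc _ _).2 h

theorem bijective_spectrumMap [Finite ι] (h : ∀ I, ⨅ i, (E i).extend ((E i).restrict I) ≤ I) :
    Function.Bijective fun p : Σ i, (S i).NakaokaSpectrum => (E p.1).spectrumMap p.2 := by
  refine ⟨?_, fun Q => ?_⟩
  · rintro ⟨i, P⟩ ⟨j, Q⟩ hPQ
    obtain rfl := eq_of_extend_le_spectrumMap disjoint (congrArg NakaokaSpectrum.ideal hPQ).le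
    exact congrArg (Sigma.mk i) ((E i).spectrumMap_injective hPQ)
  · obtain ⟨i, P, hP⟩ := exists_spectrumMap_eq h Q
    exact ⟨⟨i, P⟩, hP⟩

theorem range_spectrumMap [Finite ι] (h : ∀ I, ⨅ i, (E i).extend ((E i).restrict I) ≤ I) (i : ι) :
    Set.range (E i).spectrumMap = NakaokaSpectrum.V ((E i).extend ⊥) := by
  refine Set.Subset.antisymm (Set.range_subset_iff.2 fun P => (E i).gc.monotone_u bot_le) ?_
  intro Q hQ
  obtain ⟨j, P, rfl⟩ := exists_spectrumMap_eq h Q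
  obtain rfl := eq_of_extend_le_spectrumMap disjoint hQ
  exact ⟨P, rfl⟩

theorem nonempty_homeomorph [Finite ι] (h : ∀ I, ⨅ i, (E i).extend ((E i).restrict I) ≤ I) :
    Nonempty (R.NakaokaSpectrum ≃ₜ Σ i, (S i).NakaokaSpectrum) := by
  refine ⟨((Equiv.ofBijective _ (bijective_spectrumMap disjoint h)).toHomeomorphOfContinuousClosed
    (continuous_sigma fun i => (E i).isInducing_spectrumMap.continuous) ?_).symm⟩
  refine isClosedMap_sigma_of_finite fun i => (E i).isInducing_spectrumMap.isClosedMap ?_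
  rw [range_spectrumMap disjoint h]
  exact NakaokaSpectrum.isClosed_V _

end Family

end IdealReflection

namespace EquivariantIdempotents

variable {G : Type u} [Group G] [Finite G] {R : TambaraFunctor.{u, v} G}
variable {T : Type u} [MulAction G T] [Fintype T] (d : R.EquivariantIdempotents T)

/-- The reflection of ideals onto those of the component of an orbit of `T`. -/
noncomputable def idealReflection {H : Subgroup G} (t : (G ⧸ H) →[G] T)
    (ht : Function.Injective t) : R.IdealReflection (d.component t) where
  restrict := d.restrictIdeal t
  extend := d.extendIdeal t
  gc := d.gc_restrictIdeal_extendIdeal t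
  restrict_extend := d.restrictIdeal_extendIdeal t ht
  restrict_mul_le := d.restrictIdeal_mul_le t
  extend_mul_le := d.extendIdeal_mul_le t

theorem nonempty_homeomorph {ι : Type*} [Finite ι] {H : ι → Subgroup G}
    {t : ∀ i, (G ⧸ H i) →[G] T}
    (ht : Function.Bijective fun s : Σ i, G ⧸ H i => t s.1 s.2) :
    Nonempty (R.NakaokaSpectrum ≃ₜ Σ i, (d.component (t i)).NakaokaSpectrum) := by
  have t_injective (i : ι) : Function.Injective (t i) := ht.1.comp sigma_mk_injective
  refine IdealReflection.nonempty_homeomorph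
    (E := fun i => d.idealReflection (t i) (t_injective i)) (fun i j hij J => ?_) ?_
  · refine d.restrictIdeal_extendIdeal_of_disjoint (t j) (t i) (fun x y hxy => hij ?_) J
    exact (congrArg Sigma.fst (ht.1 (a₁ := ⟨j, x⟩) (a₂ := ⟨i, y⟩) hxy)).symm
  · refine d.iInf_extendIdeal_restrictIdeal_le t_injective fun s => ?_
    obtain ⟨⟨i, c⟩, hc⟩ := ht.2 s
    exact ⟨i, c, hc⟩

end EquivariantIdempotents

end TambaraFunctor

namespace TambaraFunctor

open GSet

variable {G : Type u} [Group G] [Finite G] {R : TambaraFunctor.{u, v} G}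

/-- The conjugation action of `G` on `R(G/e)`. -/
instance : MulSemiringAction G (R.level ⊥) where
  smul g a := R.conj g a
  one_smul a := by
    change R.conj 1 a = a
    rw [← R.ev_one a, ← R.ev_smul, one_smul]
  mul_smul g h a := by
    change R.conj (g * h) a = R.conj g (R.conj h a)
    rw [← R.ev_one a, ← R.ev_smul, ← R.ev_smul, ← R.ev_smul, mul_smul]
  smul_zero g := map_zero (R.conj g)
  smul_add g := map_add (R.conj g)
  smul_one g := map_one (R.conj g)
  smul_mul g := map_mul (R.conj g)

theorem conj_eq_smul (g : G) (a : R.level ⊥) : R.conj g a = g • a := rfl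

theorem ev_base_conj {H : Subgroup G} (h : H) (a : (R.restrict H).level ⊥) :
    R.ev (Induced.base H _ ((1 : H) : FreeOrbit H)) ((R.restrict H).conj h a) =
      R.conj h (R.ev (Induced.base H _ ((1 : H) : FreeOrbit H)) a) := by
  rw [conj, R.ev_res, ← R.ev_smul, Induced.map_base, rightMul_mk, one_mul, ← Subgroup.smul_def,
    ← map_smul, mk_smul_one]

namespace EquivariantIdempotents

variable {T : Type u} [MulAction G T] [Fintype T] (d : R.EquivariantIdempotents T)
variable {H : Subgroup G} (t : (G ⧸ H) →[G] T)

theorem elem_mul_ev_val (p : Induced H (FreeOrbit H)) (a : (d.component t).level ⊥) :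
    d.toFun (t p.coset) * R.ev p ((d.normIdempotent t).val a) =
      R.ev p ((d.normIdempotent t).val a) := by
  have ev_elem : R.ev p ((d.normIdempotent t).elem (FreeOrbit H)) = d.toFun (t p.coset) :=
    (R.ev_res _ p d.tau).trans (d.ev_tau _)
  rw [← ev_elem, ← map_mul, NormIdempotent.elem_mul_val]

theorem isClarified_component
    (h : ∀ x : R.level ⊥, IsIdempotentElem x → x * d.toFun (t ((1 : G) : G ⧸ H)) = x →
      ∀ g ∈ H, x * R.conj g x = 0 → x = 0) : (d.component t).IsClarified := by
  rintro ⟨c, c_ne_zero, c_idem, g, c_mul_conj⟩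
  let p : Induced H (FreeOrbit H) := Induced.base H _ ((1 : H) : FreeOrbit H)
  have ev_eq_zero : R.ev p ((d.normIdempotent t).val c) = 0 := by
    refine h _ ?_ ?_ g g.2 ?_
    · rw [IsIdempotentElem, ← map_mul, ← map_mul, c_idem.eq]
    · rw [mul_comm]
      exact d.elem_mul_ev_val t p c
    · have ev_conj : R.ev p ((d.normIdempotent t).val ((d.component t).conj g c)) =
          R.conj g (R.ev p ((d.normIdempotent t).val c)) := ev_base_conj g _
      rw [← ev_conj, ← map_mul, ← map_mul, c_mul_conj, map_zero, map_zero]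
  refine c_ne_zero ((d.normIdempotent t).val_injective (R.ext_free fun q => ?_))
  obtain ⟨k, rfl⟩ := MulAction.exists_smul_eq G p q
  rw [R.ev_smul, ev_eq_zero, map_zero, map_zero, map_zero]

end EquivariantIdempotents

end TambaraFunctor

section Idempotents

variable {A B : Type*} [CommRing A] [CommRing B]

theorem mul_eq_left_of_forall_minimalPrimes {a b : A} (ha : IsIdempotentElem a)
    (hb : IsIdempotentElem b) (h : ∀ p ∈ minimalPrimes A, b ∈ p → a ∈ p) : a * b = a := by
  have nilpotent : IsNilpotent (a * (1 - b)) := by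
    rw [← mem_nilradical, nilradical, Ideal.zero_eq_bot, ← Ideal.sInf_minimalPrimes,
      Submodule.mem_sInf]
    intro p hp
    have p_prime : Ideal.IsPrime p := hp.1.1
    have mul_one_sub_mem : b * (1 - b) ∈ p := hb.mul_one_sub_self ▸ p.zero_mem
    rcases p_prime.mem_or_mem mul_one_sub_mem with b_mem | one_sub_mem
    · exact Ideal.mul_mem_right _ _ (h p hp b_mem)
    · exact Ideal.mul_mem_left _ _ one_sub_mem
  have mul_one_sub_eq_zero := (ha.mul hb.one_sub).eq_zero_of_isNilpotent nilpotent
  rwa [mul_sub, mul_one, sub_eq_zero, eq_comm] at mul_one_sub_eq_zero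

theorem finite_isIdempotentElem [IsNoetherianRing A] : Finite {a : A // IsIdempotentElem a} := by
  have : Finite (minimalPrimes A) := (minimalPrimes.finite_of_isNoetherianRing A).to_subtype
  refine Finite.of_injective
    (fun a : {a : A // IsIdempotentElem a} => {p : minimalPrimes A | a.1 ∈ p.1}) fun a b hab => ?_
  have mem_iff (p) (hp : p ∈ minimalPrimes A) : a.1 ∈ p ↔ b.1 ∈ p := Set.ext_iff.1 hab ⟨p, hp⟩
  exact le_antisymm (mul_eq_left_of_forall_minimalPrimes a.2 b.2 fun p hp => (mem_iff p hp).2)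
    (mul_eq_left_of_forall_minimalPrimes b.2 a.2 fun p hp => (mem_iff p hp).1)

theorem completeOrthogonalIdempotents_sum_fiber {I S : Type*} [Fintype I] [Fintype S]
    [DecidableEq S] {e : I → A} (he : CompleteOrthogonalIdempotents e) (π : I → S) :
    CompleteOrthogonalIdempotents fun s => ∑ i with π i = s, e i where
  idem _ := he.isIdempotentElem_sum
  ortho s s' hs := by
    change (∑ i with π i = s, e i) * ∑ j with π j = s', e j = 0
    rw [Finset.sum_mul_sum]
    refine Finset.sum_eq_zero fun i hi => Finset.sum_eq_zero fun j hj => he.ortho ?_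
    rintro rfl
    exact hs (((Finset.mem_filter_univ i).1 hi).symm.trans ((Finset.mem_filter_univ i).1 hj))
  complete := (Finset.sum_fiberwise _ _ _).trans he.complete

/-- The isomorphism of Boolean algebras of idempotents given by a ring isomorphism. -/
def idempotentsOrderIso (f : A ≃+* B) :
    {a : A // IsIdempotentElem a} ≃o {b : B // IsIdempotentElem b} where
  toFun a := ⟨f a.1, a.2.map f⟩
  invFun b := ⟨f.symm b.1, b.2.map f.symm⟩
  left_inv a := Subtype.ext (f.symm_apply_apply a.1)
  right_inv b := Subtype.ext (f.apply_symm_apply b.1)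
  map_rel_iff' {a b} := by
    change f a.1 * f b.1 = f a.1 ↔ a.1 * b.1 = a.1
    rw [← map_mul, f.injective.eq_iff]

variable (A) in
/-- The primitive idempotents of `A`, encoded as the atoms of its Boolean algebra of idempotents. -/
def PrimitiveIdempotent : Type _ := {a : {a : A // IsIdempotentElem a} // IsAtom a}

namespace PrimitiveIdempotent

instance : Coe (PrimitiveIdempotent A) A := ⟨fun a => a.1.1⟩

instance [Finite {a : A // IsIdempotentElem a}] : Finite (PrimitiveIdempotent A) :=
  Subtype.finite

theorem ne_zero (a : PrimitiveIdempotent A) : (a : A) ≠ 0 := fun h => a.2.1 (Subtype.ext h)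

theorem orthogonalIdempotents : OrthogonalIdempotents fun a : PrimitiveIdempotent A => (a : A) where
  idem a := a.1.2
  ortho a b hab :=
    congrArg Subtype.val (a.2.disjoint_of_ne b.2 (Subtype.coe_injective.ne hab)).eq_bot

section Finite

variable [Finite {a : A // IsIdempotentElem a}]

theorem exists_mul_eq {x : A} (hx : IsIdempotentElem x) (h0 : x ≠ 0) :
    ∃ a : PrimitiveIdempotent A, a * x = a := by
  obtain ⟨a, ha, hax⟩ := (eq_bot_or_exists_atom_le
    (⟨x, hx⟩ : {a : A // IsIdempotentElem a})).resolve_left fun h => h0 (congrArg Subtype.val h)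
  exact ⟨⟨a, ha⟩, hax⟩

theorem completeOrthogonalIdempotents [Fintype (PrimitiveIdempotent A)] :
    CompleteOrthogonalIdempotents fun a : PrimitiveIdempotent A => (a : A) := by
  refine ⟨orthogonalIdempotents, ?_⟩
  by_contra h
  obtain ⟨a, ha⟩ := exists_mul_eq orthogonalIdempotents.isIdempotentElem_sum.one_sub
    (sub_ne_zero.2 (Ne.symm h))
  rw [mul_sub, mul_one, orthogonalIdempotents.mul_sum_of_mem (Finset.mem_univ a), sub_self] at ha
  exact a.ne_zero ha.symm

end Finite

variable {G : Type*} [Group G] [MulSemiringAction G A]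

instance : MulAction G (PrimitiveIdempotent A) where
  smul g a := ⟨idempotentsOrderIso (MulSemiringAction.toRingEquiv G A g) a.1,
    (OrderIso.isAtom_iff _ _).2 a.2⟩
  one_smul a := Subtype.ext (Subtype.ext (one_smul G (a : A)))
  mul_smul g h a := Subtype.ext (Subtype.ext (mul_smul g h (a : A)))

theorem coe_smul (g : G) (a : PrimitiveIdempotent A) :
    ((g • a : PrimitiveIdempotent A) : A) = g • (a : A) := rfl

end PrimitiveIdempotent

end Idempotents

namespace GSet

theorem exists_hom_sigma_quotient (G : Type*) [Group G] (X : Type*) [MulAction G X] :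
    ∃ π : X →[G] Σ H : Subgroup G, G ⧸ H,
      ∀ x, MulAction.stabilizer G (π x) ≤ MulAction.stabilizer G x := by
  let rep (x : X) : X := (Quotient.mk (MulAction.orbitRel G X) x).out
  have exists_smul_rep (x : X) : ∃ g : G, g • rep x = x :=
    (MulAction.orbitRel G X).symm (Quotient.mk_out (s := MulAction.orbitRel G X) x)
  have rep_smul (g : G) (x : X) : rep (g • x) = rep x :=
    congrArg Quotient.out (Quotient.sound (s := MulAction.orbitRel G X) ⟨g, rfl⟩)
  have mk_eq {x y : X} {g h : G} (hxy : x = y) (hgh : g • x = h • y) :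
      (⟨MulAction.stabilizer G x, g⟩ : Σ H : Subgroup G, G ⧸ H) =
        ⟨MulAction.stabilizer G y, h⟩ := by
    subst hxy
    refine congrArg (Sigma.mk _) (QuotientGroup.eq.2 ?_)
    rw [MulAction.mem_stabilizer_iff, mul_smul, inv_smul_eq_iff, hgh]
  choose γ hγ using exists_smul_rep
  refine ⟨⟨fun x => ⟨MulAction.stabilizer G (rep x), (γ x : G)⟩, fun g x => ?_⟩, fun x g hg => ?_⟩
  · exact mk_eq (h := g * γ x) (rep_smul g x) (by rw [hγ, mul_smul, hγ])
  · have coset_eq : (γ x : G ⧸ MulAction.stabilizer G (rep x)) = (g * γ x : G) :=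
      (eq_of_heq (Sigma.mk.inj hg).2).symm
    have mem_stabilizer := QuotientGroup.eq.1 coset_eq
    rwa [MulAction.mem_stabilizer_iff, mul_smul, mul_smul, hγ, inv_smul_eq_iff, hγ]
      at mem_stabilizer

end GSet

namespace TambaraFunctor

variable {G : Type u} [Group G] [Finite G] {R : TambaraFunctor.{u, v} G}

namespace EquivariantIdempotents

variable {T : Type u} [MulAction G T] [Fintype T] [DecidableEq T]
variable [Finite {a : R.level ⊥ // IsIdempotentElem a}] [Fintype (PrimitiveIdempotent (R.level ⊥))]

/-- The equivariant idempotents given by a map from the `G`-set of primitive idempotents of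
`R(G/e)` to `T`, the sums of its fibres. -/
def ofPrimitive (π : PrimitiveIdempotent (R.level ⊥) →[G] T) : R.EquivariantIdempotents T where
  toFun s := ∑ a with π a = s, (a : R.level ⊥)
  map_smul g s := by
    rw [conj_eq_smul, Finset.smul_sum]
    refine (Finset.sum_equiv (MulAction.toPerm g) (fun a => ?_) fun a _ => rfl).symm
    simp
  complete :=
    completeOrthogonalIdempotents_sum_fiber PrimitiveIdempotent.completeOrthogonalIdempotents π

variable {π : PrimitiveIdempotent (R.level ⊥) →[G] T}

theorem eq_of_mul_ofPrimitive_eq {a : PrimitiveIdempotent (R.level ⊥)} {s : T}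
    (h : a * (ofPrimitive π).toFun s = a) : π a = s := by
  by_contra hs
  refine a.ne_zero (h.symm.trans ?_)
  exact PrimitiveIdempotent.orthogonalIdempotents.mul_sum_of_notMem (by simpa using hs)

theorem isClarified_component_ofPrimitive
    (hπ : ∀ a, MulAction.stabilizer G (π a) ≤ MulAction.stabilizer G a) {H : Subgroup G}
    (t : (G ⧸ H) →[G] T) : ((ofPrimitive π).component t).IsClarified := by
  refine isClarified_component _ t fun x hx hxt g hg hxg => ?_
  by_contra hx0
  obtain ⟨a, hax⟩ := PrimitiveIdempotent.exists_mul_eq hx hx0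
  have π_eq : π a = t ((1 : G) : G ⧸ H) := eq_of_mul_ofPrimitive_eq (by
    rw [← hax, mul_assoc, hxt])
  have smul_eq : g • a = a := hπ a (π_eq ▸ GSet.le_stabilizer_apply_one t hg)
  refine a.ne_zero ?_
  calc (a : R.level ⊥) = a * x * (g • (a * x)) := by
        rw [hax, ← PrimitiveIdempotent.coe_smul, smul_eq, a.1.2.eq]
    _ = a * (g • a) * (x * R.conj g x) := by
        rw [smul_mul', conj_eq_smul, mul_mul_mul_comm]
    _ = 0 := by rw [hxg, mul_zero]

end EquivariantIdempotents

end TambaraFunctor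

theorem mainTheorem9_general {G : Type u} [Group G] [Finite G] (R : TambaraFunctor.{u, v} G)
    [Finite {a : R.level ⊥ // IsIdempotentElem a}] :
    ∃ S : ∀ H : Subgroup G, TambaraFunctor.{u, v} H,
      (∀ H : Subgroup G, (S H).IsClarified) ∧
      Nonempty (R.NakaokaSpectrum ≃ₜ Σ H : Subgroup G, (S H).NakaokaSpectrum) := by
  classical
  have := Fintype.ofFinite (PrimitiveIdempotent (R.level ⊥))
  have := Fintype.ofFinite (Σ H : Subgroup G, G ⧸ H)
  obtain ⟨π, hπ⟩ := GSet.exists_hom_sigma_quotient G (PrimitiveIdempotent (R.level ⊥))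
  let d := TambaraFunctor.EquivariantIdempotents.ofPrimitive π
  let t (H : Subgroup G) : (G ⧸ H) →[G] Σ H : Subgroup G, G ⧸ H := ⟨Sigma.mk H, fun _ _ => rfl⟩
  exact ⟨fun H => d.component (t H),
    fun H => TambaraFunctor.EquivariantIdempotents.isClarified_component_ofPrimitive hπ (t H),
    d.nonempty_homeomorph Function.bijective_id⟩

theorem mainTheorem9 {G : Type u} [Group G] [Finite G] (R : TambaraFunctor.{u, v} G)
    (hR : IsNoetherianRing (R.level ⊥)) :
    ∃ S : ∀ H : Subgroup G, TambaraFunctor.{u, v} H,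
      (∀ H : Subgroup G, (S H).IsClarified) ∧
      Nonempty (R.NakaokaSpectrum ≃ₜ Σ H : Subgroup G, (S H).NakaokaSpectrum) :=
  have := finite_isIdempotentElem (A := R.level ⊥)
  mainTheorem9_general R
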